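/- Consider an infinite-server queue with $k$ types of customers which is empty at time $0$. Batches of customers arrive at the epochs of a Poisson process of rate $\lambda>0$. The vectors $(x_1,\dots,x_k)$ counting the customers of each type in the batches are i.i.d. with distribution $q$ and joint probability generating function $Q(\mathbf x)=\sum_{n_1,\dots,n_k\ge0}q(n_1,\dots,n_k)\,x_1^{n_1}\cdots x_k^{n_k}$. Every customer starts service on arrival; the service times of type $i$ customers are nonnegative and i.i.d. with distribution function $B_i$; arrivals, batch sizes and service times are mutually independent. Let $N_i(t)$ be the number of type $i$ customers in service at time $t$ and $M_i(t)$ the number of type $i$ customers whose service has been completed by time $t$. Put $w_i(\mathbf z,x)=B_i(x)+(1-B_i(x))z_i$ and $\bar w_i(\mathbf z,x)=B_i(x)z_i+(1-B_i(x))$. (a) For all $\mathbf z\in\mathbb C^k$ with $|z_i|\le1$ and all $t\ge0$, $$P(\mathbf z,t)=\sum_{n_1,\dots,n_k\ge0}\mathbb P(N_1(t)=n_1,\dots,N_k(t)=n_k)\,z_1^{n_1}\cdots z_k^{n_k}=\exp\Big(\lambda\int_0^t\big[Q(w(\mathbf z,t-s))-1\big]ds\Big),$$ $$\sum_{n_1,\dots,n_k\ge0}\mathbb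 P(M_1(t)=n_1,\dots,M_k(t)=n_k)\,z_1^{n_1}\cdots z_k^{n_k}=\exp\Big(\lambda\int_0^t\big[Q(\bar w(\mathbf z,t-s))-1\big]ds\Big).$$ (b) (Collective marks.) Let $z_i\in[0,1]$ and let each type $i$ customer be coloured red with probability $z_i$ and blue with probability $1-z_i$, independently of all other customers, arrivals, batch sizes and service times. Then, for $t\ge0$, the probability that no blue customer is in service at time $t$ is $\exp\big(\lambda\int_0^t[Q(w(\mathbf z,t-s))-1]ds\big)$, and the probability that every batch which arrived in $[0,t]$ has at least one blue customer in service at time $t$ is $\exp\big(-\lambda\int_0^tQ(w(\mathbf z,t-s))ds\big)$. (c) Suppose moreover that catastrophes occur at the epochs of a Poisson process of rate $\nu>0$ independent of everything above, and that each catastrophe removes all customers present. Let $\hat P(\mathbf z,t)$ be the joint probability generating function of the numbers of customers of each type in service at time $t$ in this model. Then for all $|z_i|\le1$ and $t\ge0$, $$\hat P(\mathbf z,t)=P(\mathbf z,t)e^{-\nu t}+\nu\int_0^tP(\mathbf z,t-x)e^{-\nu(t-x)}dx .$$ For all complex $s$ with $\operatorname{Re}s>0$, the Laplace transforms $\tilde{\hat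 P}(\mathbf z,s)=\int_0^\infty e^{-st}\hat P(\mathbf z,t)dt$ and $\tilde P(\mathbf z,s+\nu)=\int_0^\infty e^{-(s+\nu)t}P(\mathbf z,t)dt$ converge absolutely and satisfy $$\tilde{\hat P}(\mathbf z,s)=\tilde P(\mathbf z,s+\nu)\Big(1+\frac{\nu}{s}\Big),\qquad s\,\tilde{\hat P}(\mathbf z,s)=(s+\nu)\,\tilde P(\mathbf z,s+\nu).$$ -/

import Mathlib

open MeasureTheory ProbabilityTheory Set

namespace BatchQueue

noncomputable section

/-- The inter-event times of an increasing sequence of event times `T 0, T 1, …` on the half-line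
`(0, ∞)`: the first one is `T 0`, the following ones are `T (n + 1) - T n`. -/
def gap {Ω : Type*} (T : ℕ → Ω → ℝ) : ℕ → Ω → ℝ
  | 0 => T 0
  | n + 1 => fun ω => T (n + 1) ω - T n ω

/-- `T 0, T 1, …` are the successive event times of a (homogeneous) Poisson process of rate `r`
on `(0, ∞)`: the inter-event times are independent and exponentially distributed with rate `r`. -/
structure IsPoissonProcess {Ω : Type*} [MeasurableSpace Ω] (P : Measure Ω) (T : ℕ → Ω → ℝ)
    (r : ℝ) : Prop where
  measurable : ∀ n, Measurable (T n)
  indep : iIndepFun (gap T) P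
  law : ∀ n, P.map (gap T n) = expMeasure r

/-- The random variables driving an infinite-server queue with `k` types of customers, arriving
in batches. Customers are labelled by `(n, i, j)`: the `j`-th customer of type `i` in batch `n`. -/
structure Data (Ω : Type*) (k : ℕ) where
  /-- arrival time of batch `n` -/
  arrival : ℕ → Ω → ℝ
  /-- number of customers of each type in batch `n` -/
  size : ℕ → Ω → Fin k → ℕ
  /-- service time of customer `(n, i, j)` -/
  service : ℕ → Fin k → ℕ → Ω → ℝ

variable {Ω : Type*} {k : ℕ}

/-- All batch arrival times, batch sizes and service times together, as one random element. -/
def Data.history (S : Data Ω k) (ω : Ω) :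
    (ℕ → ℝ) × (ℕ → Fin k → ℕ) × (ℕ → Fin k → ℕ → ℝ) :=
  (fun n => S.arrival n ω, fun n => S.size n ω, fun n i j => S.service n i j ω)

/-- The queue without catastrophes: batches arrive at the events of a Poisson process of rate
`lam`, batch size vectors are i.i.d. with distribution `q`, service times of type `i` customers
are i.i.d. nonnegative with law `ρ i`, and everything is mutually independent. -/
structure Data.IsModel [MeasurableSpace Ω] (S : Data Ω k) (P : Measure Ω) (lam : ℝ)
    (q : PMF (Fin k → ℕ)) (ρ : Fin k → Measure ℝ) : Prop where
  arrival_poisson : IsPoissonProcess P S.arrival lam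
  size_measurable : ∀ n, Measurable (S.size n)
  size_law : ∀ n, P.map (S.size n) = q.toMeasure
  size_indep : iIndepFun S.size P
  service_measurable : ∀ n i j, Measurable (S.service n i j)
  service_law : ∀ n i j, P.map (S.service n i j) = ρ i
  service_nonneg : ∀ i, ρ i (Iio 0) = 0
  service_indep : iIndepFun (fun c : ℕ × Fin k × ℕ => S.service c.1 c.2.1 c.2.2) P
  size_service_indep :
    IndepFun (fun ω n => S.size n ω) (fun ω n i j => S.service n i j ω) P
  arrival_indep :
    IndepFun (fun ω n => S.arrival n ω)
      (fun ω => ((fun n => S.size n ω), (fun n i j => S.service n i j ω))) P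

/-- `C 0, C 1, …` are the catastrophe times: a Poisson process of rate `nu`, independent of the
arrivals, batch sizes and service times. -/
structure Data.IsCatastrophes [MeasurableSpace Ω] (S : Data Ω k) (P : Measure Ω)
    (C : ℕ → Ω → ℝ) (nu : ℝ) : Prop where
  poisson : IsPoissonProcess P C nu
  indep : IndepFun (fun ω m => C m ω) S.history P

/-- A colouring of the customers: each customer of type `i` is red (`true`) with probability
`z i` and blue (`false`) otherwise, independently of all other customers, arrivals and services. -/
structure Data.IsColouring [MeasurableSpace Ω] (S : Data Ω k) (P : Measure Ω)
    (red : ℕ → Fin k → ℕ → Ω → Bool) (z : Fin k → ℝ) : Prop where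
  measurable : ∀ n i j, Measurable (red n i j)
  prob_red : ∀ n i j, P.real {ω | red n i j ω = true} = z i
  indep : iIndepFun (fun c : ℕ × Fin k × ℕ => red c.1 c.2.1 c.2.2) P
  indep_history : IndepFun (fun ω n i j => red n i j ω) S.history P

/-- The type `i` customers, as pairs (batch, position), in service at time `t` when there are no
catastrophes. -/
def Data.present (S : Data Ω k) (t : ℝ) (ω : Ω) (i : Fin k) : Set (ℕ × ℕ) :=
  {c | S.arrival c.1 ω ≤ t ∧ c.2 < S.size c.1 ω i ∧
    t < S.arrival c.1 ω + S.service c.1 i c.2 ω}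

/-- `N_i(t)`: number of type `i` customers in service at time `t`, without catastrophes. -/
def Data.inService (S : Data Ω k) (t : ℝ) (ω : Ω) (i : Fin k) : ℕ∞ :=
  (S.present t ω i).encard

/-- `M_i(t)`: number of type `i` customers whose service was completed up to time `t`, without
catastrophes. -/
def Data.served (S : Data Ω k) (t : ℝ) (ω : Ω) (i : Fin k) : ℕ∞ :=
  {c : ℕ × ℕ | S.arrival c.1 ω ≤ t ∧ c.2 < S.size c.1 ω i ∧
    S.arrival c.1 ω + S.service c.1 i c.2 ω ≤ t}.encard

/-- Number of type `i` customers in service at time `t` when every catastrophe removes all the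
customers present: no catastrophe may have occurred between the customer's arrival and `t`. -/
def Data.inServiceCat (S : Data Ω k) (C : ℕ → Ω → ℝ) (t : ℝ) (ω : Ω) (i : Fin k) : ℕ∞ :=
  {c ∈ S.present t ω i | ∀ m, ¬ (S.arrival c.1 ω ≤ C m ω ∧ C m ω ≤ t)}.encard

/-- The term `P(N_1 = n_1, …, N_k = n_k) z_1 ^ n_1 ⋯ z_k ^ n_k` of the joint generating function
of a random vector `N`. -/
def pgfTerm [MeasurableSpace Ω] (P : Measure Ω) (N : Ω → Fin k → ℕ∞) (z : Fin k → ℂ)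
    (n : Fin k → ℕ) : ℂ :=
  (P.real {ω | ∀ i, N ω i = n i} : ℂ) * ∏ i, z i ^ n i

/-- The joint probability generating function of a random vector `N`. -/
def pgf [MeasurableSpace Ω] (P : Measure Ω) (N : Ω → Fin k → ℕ∞) (z : Fin k → ℂ) : ℂ :=
  ∑' n : Fin k → ℕ, pgfTerm P N z n

/-- The joint probability generating function `Q` of the batch size distribution `q`. -/
def batchPgf (q : PMF (Fin k → ℕ)) (x : Fin k → ℂ) : ℂ :=
  ∑' n : Fin k → ℕ, ((q n).toReal : ℂ) * ∏ i, x i ^ n i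

/-- `w_i(z, x) = B_i(x) + (1 - B_i(x)) z_i`, where `B_i` is the distribution function of the
service times of type `i`. -/
def w (ρ : Fin k → Measure ℝ) (z : Fin k → ℂ) (x : ℝ) (i : Fin k) : ℂ :=
  (cdf (ρ i) x : ℂ) + (1 - (cdf (ρ i) x : ℂ)) * z i

/-- `B_i(x) z_i + (1 - B_i(x))`, the analogue of `w_i` for completed services. -/
def wServed (ρ : Fin k → Measure ℝ) (z : Fin k → ℂ) (x : ℝ) (i : Fin k) : ℂ :=
  (cdf (ρ i) x : ℂ) * z i + (1 - (cdf (ρ i) x : ℂ))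

/-- The Laplace transform `∫_0^∞ e^{-s t} f(t) dt`. -/
def laplace (f : ℝ → ℂ) (s : ℂ) : ℂ :=
  ∫ t in Ioi (0 : ℝ), Complex.exp (-s * (t : ℂ)) * f t

/-- The integral defining `laplace f s` converges absolutely. -/
def LaplaceConverges (f : ℝ → ℂ) (s : ℂ) : Prop :=
  IntegrableOn (fun t : ℝ => Complex.exp (-s * (t : ℂ)) * f t) (Ioi (0 : ℝ))

end

end BatchQueue

open Filter Topology

/-! ### The renewal equation for exponential waiting times -/

namespace BatchQueue

/-! Everything rests on the generating functional of a Poisson process with event times `T n` and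
rate `r`: if `g` is measurable, bounded by 1 and equal to 1 after time `t`, then `E ∏_{n<m} g (T n)`
tends to `exp (r ∫₀ᵗ (g - 1))`. Put `Φ(a) = exp (r ∫ₐᵗ (g - 1))` (`poissonFactor`). For `X`
exponential of rate `r`, `E[g(a+X) Φ(a+X)] = Φ(a)` (`integral_poissonFactor`), so `∏_{n≤m} g (T n) ·
Φ(T m)` has constant expectation `Φ(0)`. Almost surely `T m` eventually exceeds `t`, where `Φ = 1`,
and dominated convergence gives the limit (`IsPoissonProcess.tendsto_integral_prod`). No Poisson
counts or order statistics are used.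

Batches are marks on the arrivals. By independence and Fubini, averaging a factor `a(T) + b(T) ∏
θ(T, service)` over services and then sizes replaces it by `a(T) + b(T) Q(v(T))`, where `v` is the
mean of `θ` over a service time (`Data.IsModel.tendsto_integral_prod`). The results differ only in
the choice of `a`, `b`, `θ`.

(a) Give each counted customer of an arrival up to `t` the weight `z i`. The product over the first
`m` batches is eventually `∏ z i ^ N i`, and the mean weight of a customer arriving at `s` is `w` or
`wServed` at `t - s`.

(b) Averaging over colours turns "red or gone" into the weight `z i` while in service, so the
absence of blue customers has the generating function as its probability. For a blue customer in
every batch, each factor is one minus the no-blue indicator, and the exponent becomes `-Q`.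

(c) Given the catastrophe times, the arrivals that still count are those in a window of length `age`
before `t`, so the conditional generating function is `P(z, age)` (`integral_survivors`). The age is
distributed as the minimum of `t` and an exponential variable (`map_age`, from the same functional).
Averaging gives the formula, and its Laplace transform follows since integration divides a transform
by `s` (`laplace_primitive`). -/

lemma norm_intervalIntegral_le_of_bound {u : ℝ → ℂ} {M : ℝ} (hM : ∀ x, ‖u x‖ ≤ M) (a b : ℝ) :
    ‖∫ x in a..b, u x‖ ≤ M * |b - a| :=
  intervalIntegral.norm_integral_le_of_norm_le_const fun x _ => hM x

lemma intervalIntegrable_of_bound {u : ℝ → ℂ} {M : ℝ} (hu : Measurable u) (hM : ∀ x, ‖u x‖ ≤ M)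
    (a b : ℝ) : IntervalIntegrable u volume a b :=
  (intervalIntegrable_const (c := M)).mono_fun' hu.aestronglyMeasurable
    (Eventually.of_forall hM)

/-- Since `u` is only measurable, its primitive need not be differentiable everywhere; the Lipschitz
property supplies continuity and absolute continuity instead. -/
lemma lipschitzWith_primitive {u : ℝ → ℂ} {M : NNReal} (hu : Measurable u)
    (hM : ∀ x, ‖u x‖ ≤ M) : LipschitzWith M fun x => ∫ y in (0 : ℝ)..x, u y := by
  refine LipschitzWith.of_dist_le_mul fun x y => ?_
  have hi := fun a b => intervalIntegrable_of_bound hu hM a b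
  rw [dist_eq_norm, intervalIntegral.integral_interval_sub_left (hi _ _) (hi _ _)]
  exact norm_intervalIntegral_le_of_bound hM y x

/-- The primitive `U` of a bounded measurable function `u` satisfies
`∫₀ᴿ u exp (-U) = 1 - exp (-U R)`. -/
lemma integral_mul_exp_neg_primitive {u : ℝ → ℂ} {M : NNReal} (hu : Measurable u)
    (hM : ∀ x, ‖u x‖ ≤ M) {R : ℝ} (hR : 0 ≤ R) :
    ∫ x in (0 : ℝ)..R, u x * Complex.exp (-∫ y in (0 : ℝ)..x, u y) =
      1 - Complex.exp (-∫ y in (0 : ℝ)..R, u y) := by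
  set U : ℝ → ℂ := fun x => ∫ y in (0 : ℝ)..x, u y with hU
  have hUL : LipschitzWith M U := lipschitzWith_primitive hu hM
  have hUb : ∀ x ∈ uIcc 0 R, -U x ∈ Metric.closedBall (0 : ℂ) (M * R) := by
    intro x hx
    rw [uIcc_of_le hR] at hx
    rw [mem_closedBall_zero_iff, norm_neg]
    refine (norm_intervalIntegral_le_of_bound hM 0 x).trans ?_
    rw [sub_zero, abs_of_nonneg hx.1]
    exact mul_le_mul_of_nonneg_left hx.2 M.2
  have hexpL : LipschitzOnWith (Real.exp (M * R)).toNNReal Complex.exp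
      (Metric.closedBall (0 : ℂ) (M * R)) := by
    refine Convex.lipschitzOnWith_of_nnnorm_deriv_le
      (fun x _ => Complex.differentiableAt_exp) (fun x hx => ?_) (convex_closedBall _ _)
    rw [Complex.deriv_exp, ← NNReal.coe_le_coe, coe_nnnorm, Complex.norm_exp,
      Real.coe_toNNReal _ (Real.exp_pos _).le]
    exact Real.exp_le_exp.2 ((Complex.re_le_norm x).trans (mem_closedBall_zero_iff.1 hx))
  have hEL : LipschitzOnWith ((Real.exp (M * R)).toNNReal * M) (fun x => Complex.exp (-U x))
      (uIcc 0 R) :=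
    hexpL.comp (hUL.neg.lipschitzOnWith) hUb
  have hUc : Continuous U := hUL.continuous
  have hEc : Continuous fun x => Complex.exp (-U x) := Complex.continuous_exp.comp hUc.neg
  -- Cutting off outside `[0, R]` makes the integrand bounded on the whole line, so that its
  -- primitive is Lipschitz as well.
  set v : ℝ → ℂ := (uIcc 0 R).indicator fun x => u x * Complex.exp (-U x) with hv
  have hvm : Measurable v := (hu.mul hEc.measurable).indicator measurableSet_uIcc
  have hvb : ∀ x, ‖v x‖ ≤ (M * (Real.exp (M * R)).toNNReal : NNReal) := by
    intro x
    by_cases hx : x ∈ uIcc 0 R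
    · rw [hv, indicator_of_mem hx, norm_mul]
      push_cast
      refine mul_le_mul (hM x) ?_ (norm_nonneg _) M.2
      rw [Complex.norm_exp, Real.coe_toNNReal _ (Real.exp_pos _).le]
      exact Real.exp_le_exp.2 ((Complex.re_le_norm _).trans (mem_closedBall_zero_iff.1 (hUb x hx)))
    · rw [hv, indicator_of_notMem hx, norm_zero]
      positivity
  have hVL := (lipschitzWith_primitive hvm hvb).lipschitzOnWith (s := uIcc 0 R)
  have hac := (hEL.add hVL).absolutelyContinuousOnInterval
  have hloc : ∀ {f : ℝ → ℂ} {K : NNReal}, Measurable f → (∀ x, ‖f x‖ ≤ K) →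
      LocallyIntegrable f volume := fun hf hK =>
    (locallyIntegrable_const ((_ : NNReal) : ℝ)).mono hf.aestronglyMeasurable
      (Eventually.of_forall fun x => (hK x).trans (le_abs_self _))
  -- By Lebesgue differentiation the two derivatives `-u exp (-U)` and `u exp (-U)` cancel almost
  -- everywhere; an absolutely continuous function with a.e. zero derivative is constant.
  have h0 : ∀ᵐ x, x ∈ uIcc 0 R →
      HasDerivAt (fun x => Complex.exp (-U x) + ∫ y in (0 : ℝ)..x, v y) 0 x := by
    filter_upwards [LocallyIntegrable.ae_hasDerivAt_integral (hloc hu hM), 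
      LocallyIntegrable.ae_hasDerivAt_integral (hloc hvm hvb)]
      with x h1 h2 hx
    refine HasDerivAt.congr_deriv (((h1 0).neg.cexp).add (h2 0)) ?_
    rw [hv, indicator_of_mem hx]
    simp only [Pi.neg_apply, hU]
    ring
  obtain ⟨C, hC⟩ := hac.const_of_ae_hasDerivAt_zero h0
  have e0 := hC 0 left_mem_uIcc
  have e1 := hC R right_mem_uIcc
  have e2 : ∫ x in (0 : ℝ)..R, v x = ∫ x in (0 : ℝ)..R, u x * Complex.exp (-U x) :=
    intervalIntegral.integral_congr fun x hx => by rw [hv, indicator_of_mem hx]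
  simp only [hU, intervalIntegral.integral_same, neg_zero, Complex.exp_zero, add_zero] at e0 e1 e2 ⊢
  rw [← e2, eq_sub_iff_add_eq, add_comm, e1, e0]

lemma integral_expMeasure {r : ℝ} (hr : 0 < r) (f : ℝ → ℂ) :
    ∫ x, f x ∂(expMeasure r) = ∫ x in Ioi (0 : ℝ), (r * Complex.exp (-(r * x))) * f x := by
  have h1 : expMeasure r = volume.withDensity
      fun x => ENNReal.ofReal (exponentialPDFReal r x) := rfl
  rw [h1, integral_withDensity_eq_integral_toReal_smul
    (measurable_exponentialPDFReal r).ennreal_ofReal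
    (Eventually.of_forall fun x => ENNReal.ofReal_lt_top),
    -- The density is nonzero at 0, so the pointwise comparison is made on the closed half-line.
    ← integral_Ici_eq_integral_Ioi, ← integral_indicator measurableSet_Ici]
  congr 1
  ext x
  by_cases hx : 0 ≤ x
  · have h2 := exponentialPDF_of_nonneg (r := r) hx
    rw [exponentialPDF] at h2
    rw [indicator_of_mem (mem_Ici.2 hx), h2, ENNReal.toReal_ofReal (by positivity),
      Complex.real_smul]
    push_cast
    ring
  · have h2 := exponentialPDF_of_neg (r := r) (not_le.1 hx)
    rw [exponentialPDF] at h2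
    rw [indicator_of_notMem (by simpa using hx), h2]
    simp

lemma expMeasure_Iic_zero {r : ℝ} (hr : 0 < r) : expMeasure r (Iic 0) = 0 := by
  have := isProbabilityMeasure_expMeasure hr
  have h := cdf_expMeasure_eq hr 0
  rw [cdf_eq_real] at h
  simpa [measureReal_def, ENNReal.toReal_eq_zero_iff] using h

/-- The expected value of `∏ g (T n)` over the events after time `a` of a Poisson process with
rate `r`, when `g = 1` after time `t`. -/
noncomputable def poissonFactor (r t : ℝ) (g : ℝ → ℂ) (a : ℝ) : ℂ :=
  Complex.exp (r * ∫ s in a..t, (g s - 1))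

section

variable {r t : ℝ} {g : ℝ → ℂ}

lemma norm_sub_one_le (hb : ∀ s, ‖g s‖ ≤ 1) (s : ℝ) : ‖g s - 1‖ ≤ (2 : NNReal) := by
  refine (norm_sub_le _ _).trans ?_
  have := hb s
  norm_num
  linarith

lemma poissonFactor_eq (hg : Measurable g) (hb : ∀ s, ‖g s‖ ≤ 1) (a : ℝ) :
    poissonFactor r t g a = Complex.exp (r * ∫ s in (0 : ℝ)..t, (g s - 1)) *
      Complex.exp (-(r * ∫ s in (0 : ℝ)..a, (g s - 1))) := by
  have hi := fun a b => intervalIntegrable_of_bound (hg.sub_const 1) (norm_sub_one_le hb) a b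
  rw [poissonFactor, ← Complex.exp_add, ← intervalIntegral.integral_interval_sub_left (hi 0 t)
    (hi 0 a)]
  congr 1
  ring

lemma continuous_poissonFactor (hg : Measurable g) (hb : ∀ s, ‖g s‖ ≤ 1) :
    Continuous (poissonFactor r t g) := by
  have h := (lipschitzWith_primitive (hg.sub_const 1) (norm_sub_one_le hb)).continuous
  rw [funext (poissonFactor_eq (r := r) (t := t) hg hb)]
  fun_prop

/-- The interval is traversed backwards, but it lies beyond `t`, where `g - 1` vanishes. -/
lemma poissonFactor_of_le (h1 : ∀ s, t < s → g s = 1) {a : ℝ} (ha : t ≤ a) :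
    poissonFactor r t g a = 1 := by
  have h : ∫ s in a..t, (g s - 1) = 0 := by
    rw [intervalIntegral.integral_of_ge ha,
      setIntegral_congr_fun (g := fun _ => (0 : ℂ)) measurableSet_Ioc
        (fun s hs => by simp only [h1 s hs.1, sub_self])]
    simp
  rw [poissonFactor, h]
  simp

/-- The real part of `g - 1` is nonpositive because `‖g‖ ≤ 1`; the orientation `a ≤ t` keeps this
sign in the integral. -/
lemma norm_poissonFactor_le_of_le (hr : 0 ≤ r) (hg : Measurable g) (hb : ∀ s, ‖g s‖ ≤ 1)
    {a : ℝ} (ha : a ≤ t) : ‖poissonFactor r t g a‖ ≤ 1 := by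
  have hi := intervalIntegrable_of_bound (hg.sub_const 1) (norm_sub_one_le hb) a t
  rw [poissonFactor, Complex.norm_exp, Real.exp_le_one_iff, Complex.re_ofReal_mul]
  refine mul_nonpos_of_nonneg_of_nonpos hr ?_
  rw [intervalIntegral.integral_of_le ha]
  have h2 : RCLike.re (∫ s in Ioc a t, (g s - 1)) = ∫ s in Ioc a t, RCLike.re (g s - 1) :=
    (integral_re hi.1).symm
  change RCLike.re (∫ s in Ioc a t, (g s - 1)) ≤ 0
  rw [h2]
  refine integral_nonpos fun s => ?_
  have := (Complex.re_le_norm (g s)).trans (hb s)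
  simpa using this

lemma norm_poissonFactor_le (hr : 0 ≤ r) (hg : Measurable g) (hb : ∀ s, ‖g s‖ ≤ 1)
    (h1 : ∀ s, t < s → g s = 1) (a : ℝ) : ‖poissonFactor r t g a‖ ≤ 1 := by
  rcases le_total a t with ha | ha
  · exact norm_poissonFactor_le_of_le hr hg hb ha
  · rw [poissonFactor_of_le h1 ha, norm_one]

/-- The renewal equation obtained by conditioning on the first event after time `a`. -/
lemma integral_poissonFactor (hr : 0 < r) (hg : Measurable g) (hb : ∀ s, ‖g s‖ ≤ 1)
    (h1 : ∀ s, t < s → g s = 1) (a : ℝ) :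
    ∫ x, g (a + x) * poissonFactor r t g (a + x) ∂(expMeasure r) = poissonFactor r t g a := by
  set u : ℝ → ℂ := fun x => r * g (a + x) with hu
  have hum : Measurable u := (hg.comp (measurable_const_add a)).const_mul _
  have hub : ∀ x, ‖u x‖ ≤ r.toNNReal := fun x => by
    rw [hu, norm_mul, Complex.norm_real, Real.coe_toNNReal _ hr.le, Real.norm_of_nonneg hr.le]
    exact mul_le_of_le_one_right hr.le (hb _)
  have hi := fun a b => intervalIntegrable_of_bound (hg.sub_const 1) (norm_sub_one_le hb) a b
  have hgi := fun a b => intervalIntegrable_of_bound hg hb a b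
  -- The exponential density cancels the `-1` in the integrand of `Φ`, leaving `Φ(a)` times `exp
  -- (-U)` for the primitive `U` of `u = r g(a + ·)`.
  have key : ∀ x : ℝ, Complex.exp (-(r * x)) * poissonFactor r t g (a + x) =
      poissonFactor r t g a * Complex.exp (-∫ y in (0 : ℝ)..x, u y) := fun x => by
    have e1 : ∫ y in (0 : ℝ)..x, u y = r * ∫ s in a..(a + x), g s := by
      rw [hu, intervalIntegral.integral_const_mul,
        intervalIntegral.integral_comp_add_left (fun s => g s) a, add_zero]
    have e2 : ∫ s in a..(a + x), (g s - 1) = (∫ s in a..(a + x), g s) - x := by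
      rw [intervalIntegral.integral_sub (hgi _ _) intervalIntegrable_const]
      simp
    rw [poissonFactor, poissonFactor, ← Complex.exp_add, ← Complex.exp_add, e1,
      ← intervalIntegral.integral_add_adjacent_intervals (hi a (a + x)) (hi (a + x) t), e2]
    congr 1
    ring
  have hlim0 : Tendsto (fun x : ℝ => Complex.exp (-(r * x)) * poissonFactor r t g (a + x)) atTop
      (𝓝 0) := by
    refine squeeze_zero_norm (a := fun x => Real.exp (-(r * x))) (fun x => ?_) ?_
    · rw [norm_mul, Complex.norm_exp]
      simp only [Complex.neg_re, Complex.re_ofReal_mul, Complex.ofReal_re]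
      exact mul_le_of_le_one_right (Real.exp_pos _).le (norm_poissonFactor_le hr.le hg hb h1 _)
    · exact Real.tendsto_exp_neg_atTop_nhds_zero.comp (tendsto_id.const_mul_atTop hr)
  have hpc := continuous_poissonFactor (r := r) (t := t) hg hb
  have hint : IntegrableOn (fun x : ℝ => (r * Complex.exp (-(r * x))) *
      (g (a + x) * poissonFactor r t g (a + x))) (Ioi 0) := by
    have hd : IntegrableOn (fun x : ℝ => r * Real.exp (-r * x)) (Ioi 0) :=
      (exp_neg_integrableOn_Ioi 0 hr).const_mul r
    refine hd.mono' ?_ (Eventually.of_forall fun x => ?_)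
    · have : Measurable fun x : ℝ => (r * Complex.exp (-(r * x))) *
        (g (a + x) * poissonFactor r t g (a + x)) := by
        have := hpc.measurable
        fun_prop
      exact this.aestronglyMeasurable
    · rw [norm_mul, norm_mul, norm_mul, Complex.norm_exp, Complex.norm_real,
        Real.norm_of_nonneg hr.le]
      simp only [Complex.neg_re, Complex.re_ofReal_mul, Complex.ofReal_re, neg_mul]
      exact mul_le_of_le_one_right (by positivity)
        (mul_le_one₀ (hb _) (norm_nonneg _) (norm_poissonFactor_le hr.le hg hb h1 _))
  rw [integral_expMeasure hr]
  refine tendsto_nhds_unique (intervalIntegral_tendsto_integral_Ioi 0 hint tendsto_id) ?_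
  -- After factoring out `Φ(a)` the integral up to `R` is that of `u exp (-U)`, which is explicit;
  -- the remaining boundary term tends to zero by `hlim0`.
  have hcl : ∀ R : ℝ, 0 ≤ R → ∫ x in (0 : ℝ)..R, (r * Complex.exp (-(r * x))) *
      (g (a + x) * poissonFactor r t g (a + x)) =
      poissonFactor r t g a - Complex.exp (-(r * R)) * poissonFactor r t g (a + R) := fun R hR => by
    rw [key, ← mul_one_sub, ← integral_mul_exp_neg_primitive hum hub hR,
      ← intervalIntegral.integral_const_mul]
    refine intervalIntegral.integral_congr fun x _ => ?_
    have := key x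
    simp only [hu] at this ⊢
    linear_combination (r * g (a + x)) * this
  have hlim := (tendsto_const_nhds (x := poissonFactor r t g a)).sub hlim0
  rw [sub_zero] at hlim
  refine hlim.congr' ?_
  filter_upwards [eventually_ge_atTop 0] with R hR
  exact (hcl R hR).symm

end
end BatchQueue

/-! ### The generating functional of a Poisson process -/

namespace BatchQueue

lemma sum_gap {Ω : Type*} (T : ℕ → Ω → ℝ) (n : ℕ) (ω : Ω) :
    ∑ j ∈ Finset.range (n + 1), gap T j ω = T n ω := by
  induction n with
  | zero => simp [gap]
  | succ n ih =>
    rw [Finset.sum_range_succ, ih]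
    simp [gap]

variable {Ω : Type*} [MeasurableSpace Ω] {P : Measure Ω}

lemma integrable_of_norm_le_one [IsFiniteMeasure P] {f : Ω → ℂ} (hf : Measurable f)
    (hb : ∀ x, ‖f x‖ ≤ 1) : Integrable f P :=
  Integrable.of_bound hf.aestronglyMeasurable 1 (Eventually.of_forall hb)

/-- Fubini's theorem for a bounded function of two independent random variables. -/
lemma integral_indepFun_eq [IsProbabilityMeasure P]
    {α β : Type*} [MeasurableSpace α] [MeasurableSpace β] {X : Ω → α}
    {Y : Ω → β} (hX : Measurable X) (hY : Measurable Y) (h : IndepFun X Y P) {F : α → β → ℂ}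
    (hF : Measurable (Function.uncurry F)) {M : ℝ} (hb : ∀ x y, ‖F x y‖ ≤ M) :
    ∫ ω, F (X ω) (Y ω) ∂P = ∫ ω, ∫ ω', F (X ω) (Y ω') ∂P ∂P := by
  have h1 := (indepFun_iff_map_prod_eq_prod_map_map hX.aemeasurable hY.aemeasurable).1 h
  have := Measure.isProbabilityMeasure_map (μ := P) hX.aemeasurable
  have := Measure.isProbabilityMeasure_map (μ := P) hY.aemeasurable
  have e1 : ∫ ω, F (X ω) (Y ω) ∂P = ∫ p, Function.uncurry F p ∂(P.map fun ω => (X ω, Y ω)) :=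
    (integral_map (hX.prodMk hY).aemeasurable hF.aestronglyMeasurable).symm
  have hint : Integrable (Function.uncurry F) ((P.map X).prod (P.map Y)) :=
    Integrable.of_bound hF.aestronglyMeasurable M (Eventually.of_forall fun p => hb p.1 p.2)
  have hsm : StronglyMeasurable fun x => ∫ y, F x y ∂(P.map Y) :=
    hF.stronglyMeasurable.integral_prod_right
  rw [e1, h1, integral_prod _ hint]
  simp only [Function.uncurry_apply_pair]
  rw [integral_map hX.aemeasurable hsm.aestronglyMeasurable]
  refine integral_congr_ae (Eventually.of_forall fun ω => ?_)
  exact integral_map hY.aemeasurable (hF.comp measurable_prodMk_left).aestronglyMeasurable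

/-- Product formula for bounded functions of finitely many members of an independent family. -/
lemma integral_finsetProd_of_iIndepFun {ι β : Type*} [MeasurableSpace β] {V : ι → Ω → β}
    (hV : iIndepFun V P) (hm : ∀ i, Measurable (V i)) (A : Finset ι) {f : ι → β → ℂ}
    (hf : ∀ i, Measurable (f i)) :
    ∫ ω, ∏ i ∈ A, f i (V i ω) ∂P = ∏ i ∈ A, ∫ ω, f i (V i ω) ∂P := by
  have h := iIndepFun.integral_fun_prod_comp (f := fun i : A => f i)
    (hV.precomp (g := ((↑) : A → ι)) Subtype.val_injective) (fun i => (hm i).aemeasurable)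
    (fun i => (hf i).aestronglyMeasurable)
  rw [← Finset.prod_coe_sort A fun i => ∫ ω, f i (V i ω) ∂P, ← h]
  exact integral_congr_ae (Eventually.of_forall fun ω =>
    (Finset.prod_coe_sort A fun i => f i (V i ω)).symm)

namespace IsPoissonProcess

variable {T : ℕ → Ω → ℝ} {r : ℝ}

lemma measurable_gap (h : IsPoissonProcess P T r) : ∀ n, Measurable (gap T n)
  | 0 => h.measurable 0
  | n + 1 => (h.measurable (n + 1)).sub (h.measurable n)

lemma ae_gap_pos (h : IsPoissonProcess P T r) (hr : 0 < r) : ∀ᵐ ω ∂P, ∀ n, 0 < gap T n ω := by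
  refine ae_all_iff.2 fun n => ?_
  have h1 := expMeasure_Iic_zero hr
  rw [← h.law n, Measure.map_apply (h.measurable_gap n) measurableSet_Iic] at h1
  rw [ae_iff]
  convert h1 using 2
  ext ω
  simp

lemma ae_pos (h : IsPoissonProcess P T r) (hr : 0 < r) : ∀ᵐ ω ∂P, ∀ n, 0 < T n ω := by
  filter_upwards [h.ae_gap_pos hr] with ω hω n
  rw [← sum_gap T n ω]
  exact Finset.sum_pos (fun j _ => hω j) (by simp)

/-- This value is less than 1, which makes the Chernoff bound for `T n` geometric in `n`. -/
lemma mgf_gap (h : IsPoissonProcess P T r) (hr : 0 < r) (n : ℕ) :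
    mgf (gap T n) P (-1) = r / (r + 1) := by
  have h1 : ∫ x, Complex.exp (-x) ∂(expMeasure r) = ((r / (r + 1) : ℝ) : ℂ) := by
    rw [integral_expMeasure hr]
    have h2 : ∀ x : ℝ, (r * Complex.exp (-(r * x))) * Complex.exp (-x) =
        ((r * Real.exp (-(r + 1) * x) : ℝ) : ℂ) := fun x => by
      rw [mul_assoc, ← Complex.exp_add]
      push_cast
      congr 2
      ring
    simp_rw [h2]
    rw [integral_complex_ofReal, integral_const_mul, integral_exp_mul_Ioi (by linarith)]
    congr 1
    have : r + 1 ≠ 0 := by linarith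
    simp only [mul_zero, Real.exp_zero]
    field_simp
  have h3 : ∀ x : ℝ, Complex.exp (-x) = ((Real.exp (-x) : ℝ) : ℂ) := fun x => by push_cast; rfl
  simp_rw [h3] at h1
  rw [integral_complex_ofReal, Complex.ofReal_inj, ← h.law n,
    integral_map (h.measurable_gap n).aemeasurable (by fun_prop)] at h1
  rw [mgf, ← h1]
  simp

/-- Chernoff's bound with parameter `-1` gives `P(T n ≤ t) ≤ e^t c^(n+1)` with `c = r / (r + 1) <
1`. This is summable, and Borel–Cantelli applies. -/
lemma ae_eventually_lt [IsProbabilityMeasure P] (h : IsPoissonProcess P T r) (hr : 0 < r) (t : ℝ) :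
    ∀ᵐ ω ∂P, ∀ᶠ n in atTop, t < T n ω := by
  set c := r / (r + 1) with hc
  have hc0 : 0 ≤ c := by positivity
  have hc1 : c < 1 := by rw [hc, div_lt_one (by linarith)]; linarith
  have hT : ∀ n, T n = ∑ j ∈ Finset.range (n + 1), gap T j := fun n => by
    ext ω
    rw [Finset.sum_apply, sum_gap]
  have hpos := h.ae_pos hr
  have hint : ∀ n, Integrable (fun ω => Real.exp (-1 * T n ω)) P := fun n => by
    refine Integrable.of_bound ((h.measurable n).const_mul _).exp.aestronglyMeasurable 1 ?_
    filter_upwards [hpos] with ω hω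
    rw [Real.norm_of_nonneg (Real.exp_pos _).le]
    exact Real.exp_le_one_iff.2 (by linarith [hω n])
  have hbd : ∀ n, P {ω | T n ω ≤ t} ≤ ENNReal.ofReal (Real.exp t * c * c ^ n) := fun n => by
    have h1 := measure_le_le_exp_mul_mgf (μ := P) (X := T n) t (t := -1) (by norm_num) (hint n)
    have h2 : mgf (T n) P (-1) = c ^ (n + 1) := by
      rw [hT n, h.indep.mgf_sum h.measurable_gap, Finset.prod_congr rfl fun j _ => h.mgf_gap hr j]
      rw [Finset.prod_const, Finset.card_range]
    rw [h2] at h1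
    rw [← ofReal_measureReal]
    refine ENNReal.ofReal_le_ofReal (h1.trans_eq ?_)
    rw [pow_succ]
    simp only [neg_neg, one_mul]
    ring
  have hsum : ∑' n, P {ω | T n ω ≤ t} ≠ ⊤ := by
    refine ne_top_of_le_ne_top ?_ (ENNReal.tsum_le_tsum hbd)
    exact ((summable_geometric_of_lt_one hc0 hc1).mul_left _).tsum_ofReal_ne_top
  filter_upwards [ae_eventually_notMem hsum] with ω hω
  filter_upwards [hω] with n hn
  simpa using hn

/-- The times `T 0, …, T m` are partial sums of the first `m + 1` gaps, which are jointly
independent of the next one. -/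
lemma indepFun_prod_gap (h : IsPoissonProcess P T r) {g : ℝ → ℂ} (hg : Measurable g) (m : ℕ) :
    IndepFun (fun ω => (∏ n ∈ Finset.range (m + 1), g (T n ω), T m ω)) (gap T (m + 1)) P := by
  have h1 := h.indep.indepFun_finset (Finset.range (m + 1)) {m + 1} (by simp) h.measurable_gap
  -- The default 0 never enters: only partial sums with `n ≤ m` are used.
  let ext0 : (Finset.range (m + 1) → ℝ) → ℕ → ℝ := fun y j =>
    if hj : j ∈ Finset.range (m + 1) then y ⟨j, hj⟩ else 0
  have hext : ∀ j, Measurable fun y => ext0 y j := fun j => by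
    by_cases hj : j ∈ Finset.range (m + 1)
    · simpa only [ext0, dif_pos hj] using measurable_pi_apply _
    · simpa only [ext0, dif_neg hj] using measurable_const
  let part : (Finset.range (m + 1) → ℝ) → ℕ → ℝ := fun y n =>
    ∑ j ∈ Finset.range (n + 1), ext0 y j
  have hpart : ∀ n, Measurable fun y => part y n := fun n =>
    Finset.measurable_sum _ fun j _ => hext j
  have hlast : Measurable fun y : ({m + 1} : Finset ℕ) → ℝ => y ⟨m + 1, by simp⟩ :=
    measurable_pi_apply _
  have h2 := h1.comp (φ := fun y => (∏ n ∈ Finset.range (m + 1), g (part y n), part y m))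
    ((Finset.measurable_fun_prod _ fun n _ => hg.comp (hpart n)).prodMk (hpart m)) hlast
  have h3 : ∀ ω, ∀ n ∈ Finset.range (m + 1),
      part (fun i : Finset.range (m + 1) => gap T i ω) n = T n ω := fun ω n hn => by
    rw [← sum_gap T n ω]
    refine Finset.sum_congr rfl fun j hj => dif_pos ?_
    rw [Finset.mem_range] at *
    omega
  have h4 : (fun ω => (∏ n ∈ Finset.range (m + 1), g (T n ω), T m ω)) =
      (fun y => (∏ n ∈ Finset.range (m + 1), g (part y n), part y m)) ∘
        fun ω (i : Finset.range (m + 1)) => gap T i ω := by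
    funext ω
    exact Prod.ext (Finset.prod_congr rfl fun n hn => congrArg g (h3 ω n hn).symm)
      (h3 ω m (by simp)).symm
  rw [h4]
  exact h2

/-- A martingale argument: given the first `m + 1` events, the last gap is a fresh exponential
variable and the renewal equation at `a = T m` removes the newest factor. -/
lemma integral_prod_mul_poissonFactor [IsProbabilityMeasure P]
    (h : IsPoissonProcess P T r) (hr : 0 < r) {t : ℝ}
    {g : ℝ → ℂ} (hg : Measurable g) (hb : ∀ s, ‖g s‖ ≤ 1) (h1 : ∀ s, t < s → g s = 1) (m : ℕ) :
    ∫ ω, (∏ n ∈ Finset.range (m + 1), g (T n ω)) * poissonFactor r t g (T m ω) ∂P =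
      poissonFactor r t g 0 := by
  have hpm := (continuous_poissonFactor (r := r) (t := t) hg hb).measurable
  have hpb := norm_poissonFactor_le hr.le hg hb h1
  have hren : ∀ n a, ∫ ω, g (a + gap T n ω) * poissonFactor r t g (a + gap T n ω) ∂P =
      poissonFactor r t g a := fun n a => by
    rw [← integral_poissonFactor hr hg hb h1 a, ← h.law n,
      integral_map (h.measurable_gap n).aemeasurable]
    exact Measurable.aestronglyMeasurable (by fun_prop)
  induction m with
  | zero =>
    rw [← hren 0 0]
    simp [gap]
  | succ m ih =>
    set X : Ω → ℂ × ℝ := fun ω => (∏ n ∈ Finset.range (m + 1), g (T n ω), T m ω) with hX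
    have hXm : Measurable X :=
      (Finset.measurable_fun_prod _ fun n _ => hg.comp (h.measurable n)).prodMk (h.measurable m)
    -- Fubini is applied to a function on all of `ℂ × ℝ`, which must be bounded; clipping to the
    -- unit disc achieves this and leaves the actual products unchanged.
    let clip : ℂ → ℂ := fun p => if ‖p‖ ≤ 1 then p else 0
    have hclm : Measurable clip :=
      Measurable.ite (measurableSet_le measurable_norm measurable_const) measurable_id
        measurable_const
    have hclb : ∀ p, ‖clip p‖ ≤ 1 := fun p => by
      by_cases hp : ‖p‖ ≤ 1 <;> simp [clip, hp]
    have hcl : ∀ ω, clip (X ω).1 = (X ω).1 := fun ω => if_pos (by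
      rw [hX, norm_prod]
      exact Finset.prod_le_one (fun _ _ => norm_nonneg _) fun _ _ => hb _)
    have key := integral_indepFun_eq hXm (h.measurable_gap (m + 1)) (h.indepFun_prod_gap hg m)
      (F := fun x y => clip x.1 * (g (x.2 + y) * poissonFactor r t g (x.2 + y))) (M := 1)
      (by simp only [Function.uncurry_def]; fun_prop) (fun x y => by
        rw [norm_mul, norm_mul]
        exact mul_le_one₀ (hclb _) (by positivity)
          (mul_le_one₀ (hb _) (norm_nonneg _) (hpb _)))
    simp_rw [hcl, integral_const_mul, hren] at key
    rw [← ih, ← key]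
    refine integral_congr_ae (Eventually.of_forall fun ω => ?_)
    have hT : (X ω).2 + gap T (m + 1) ω = T (m + 1) ω := by simp [hX, gap]
    simp only [hT]
    rw [Finset.prod_range_succ, mul_assoc]

/-- The generating functional of a Poisson process. -/
theorem tendsto_integral_prod [IsProbabilityMeasure P]
    (h : IsPoissonProcess P T r) (hr : 0 < r) {t : ℝ}
    {g : ℝ → ℂ} (hg : Measurable g) (hb : ∀ s, ‖g s‖ ≤ 1) (h1 : ∀ s, t < s → g s = 1) :
    Tendsto (fun m => ∫ ω, ∏ n ∈ Finset.range m, g (T n ω) ∂P) atTop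
      (𝓝 (Complex.exp (r * ∫ s in (0 : ℝ)..t, (g s - 1)))) := by
  rw [← tendsto_add_atTop_iff_nat 1]
  have hpm := (continuous_poissonFactor (r := r) (t := t) hg hb).measurable
  have hpb := norm_poissonFactor_le hr.le hg hb h1
  have hprod : ∀ m, Measurable fun ω => ∏ n ∈ Finset.range m, g (T n ω) := fun m =>
    Finset.measurable_fun_prod _ fun n _ => hg.comp (h.measurable n)
  have hprodb : ∀ m ω, ‖∏ n ∈ Finset.range m, g (T n ω)‖ ≤ 1 := fun m ω => by
    rw [norm_prod]
    exact Finset.prod_le_one (fun _ _ => norm_nonneg _) fun _ _ => hb _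
  have hfm : ∀ m, Measurable fun ω => poissonFactor r t g (T m ω) := fun m =>
    hpm.comp (h.measurable m)
  -- Dropping the factor `Φ(T m)` costs nothing in the limit, as it equals 1 once `T m > t`.
  have hlim : Tendsto (fun m => ∫ ω, (∏ n ∈ Finset.range (m + 1), g (T n ω)) *
      (1 - poissonFactor r t g (T m ω)) ∂P) atTop (𝓝 (∫ _, (0 : ℂ) ∂P)) := by
    refine tendsto_integral_of_dominated_convergence (fun _ => 2)
      (fun m => ((hprod _).mul ((hfm m).const_sub 1)).aestronglyMeasurable)
      (integrable_const _) (fun m => Eventually.of_forall fun ω => ?_) ?_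
    · rw [norm_mul]
      refine (mul_le_of_le_one_left (norm_nonneg _) (hprodb _ _)).trans ?_
      refine (norm_sub_le _ _).trans ?_
      rw [norm_one]
      linarith [hpb (T m ω)]
    · filter_upwards [h.ae_eventually_lt hr t] with ω hω
      refine tendsto_const_nhds.congr' ?_
      filter_upwards [hω] with m hm
      rw [poissonFactor_of_le h1 hm.le, sub_self, mul_zero]
  rw [integral_zero] at hlim
  have := hlim.add_const (poissonFactor r t g 0)
  rw [zero_add] at this
  refine this.congr fun m => ?_
  rw [← h.integral_prod_mul_poissonFactor hr hg hb h1 m, ← integral_add]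
  · exact integral_congr_ae (Eventually.of_forall fun ω => by ring)
  · refine Integrable.of_bound ((hprod _).mul ((hfm m).const_sub 1)).aestronglyMeasurable 2
      (Eventually.of_forall fun ω => ?_)
    rw [norm_mul]
    refine (mul_le_of_le_one_left (norm_nonneg _) (hprodb _ _)).trans ?_
    refine (norm_sub_le _ _).trans ?_
    rw [norm_one]
    linarith [hpb (T m ω)]
  · refine integrable_of_norm_le_one ((hprod _).mul (hfm m)) fun ω => ?_
    rw [norm_mul]
    exact mul_le_one₀ (hprodb _ _) (norm_nonneg _) (hpb _)

end IsPoissonProcess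
end BatchQueue

/-! ### Averaging over batch sizes, service times and colours -/

namespace BatchQueue

section Deterministic

lemma prod_range_eq_prod_range_ite {N M : ℕ} (h : N ≤ M) (f : ℕ → ℂ) :
    ∏ j ∈ Finset.range N, f j = ∏ j ∈ Finset.range M, if j < N then f j else 1 := by
  rw [← Finset.prod_filter]
  congr 1
  ext j
  simp only [Finset.mem_range, Finset.mem_filter]
  omega

lemma norm_finsetProd_le_one {ι : Type*} (A : Finset ι) {f : ι → ℂ} (hf : ∀ i ∈ A, ‖f i‖ ≤ 1) :
    ‖∏ i ∈ A, f i‖ ≤ 1 := by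
  rw [norm_prod]
  exact Finset.prod_le_one (fun _ _ => norm_nonneg _) hf

/-- The product over all customers of a batch with size vector `x` of the factors `f i j`. -/
noncomputable def batchProd {k : ℕ} (x : Fin k → ℕ) (f : Fin k → ℕ → ℂ) : ℂ :=
  ∏ i, ∏ j ∈ Finset.range (x i), f i j

lemma norm_batchProd_le_one {k : ℕ} (x : Fin k → ℕ) {f : Fin k → ℕ → ℂ}
    (hf : ∀ i j, ‖f i j‖ ≤ 1) : ‖batchProd x f‖ ≤ 1 :=
  norm_finsetProd_le_one _ fun _ _ => norm_finsetProd_le_one _ fun _ _ => hf _ _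

end Deterministic

/-- The random number of factors takes countably many values, so measurability can be checked with
that number frozen. -/
lemma measurable_prod_range {α : Type*} [MeasurableSpace α] {N : α → ℕ} {f : ℕ → α → ℂ}
    (hN : Measurable N) (hf : ∀ j, Measurable (f j)) :
    Measurable fun x => ∏ j ∈ Finset.range (N x), f j x := by
  have h : Measurable fun p : α × ℕ => ∏ j ∈ Finset.range p.2, f j p.1 :=
    measurable_from_prod_countable_left fun n =>
      Finset.measurable_fun_prod (Finset.range n) fun j _ => hf j
  exact h.comp (measurable_id.prodMk hN)

lemma measurable_batchProd {α : Type*} [MeasurableSpace α] {k : ℕ} {x : α → Fin k → ℕ}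
    {f : α → Fin k → ℕ → ℂ} (hx : Measurable x) (hf : ∀ i j, Measurable fun a => f a i j) :
    Measurable fun a => batchProd (x a) (f a) :=
  Finset.measurable_fun_prod _ fun i _ =>
    measurable_prod_range ((measurable_pi_apply i).comp hx) (hf i)

variable {Ω : Type*} [MeasurableSpace Ω] {P : Measure Ω}

/-- A product formula `∫ ∏ Y = ∏ ∫ Y` extends from `Y` to affine functions of `Y`. -/
lemma integral_prod_affine [IsProbabilityMeasure P] {ι : Type*} {Y : ι → Ω → ℂ} {y : ι → ℂ}
    (hY : ∀ n, Measurable (Y n)) (hb : ∀ n ω, ‖Y n ω‖ ≤ 1)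
    (h : ∀ A : Finset ι, ∫ ω, ∏ n ∈ A, Y n ω ∂P = ∏ n ∈ A, y n) (a b : ι → ℂ) (A : Finset ι) :
    ∫ ω, ∏ n ∈ A, (a n + b n * Y n ω) ∂P = ∏ n ∈ A, (a n + b n * y n) := by
  classical
  -- Expanding over subsets leaves only subproducts of the `Y n`; this is why `h` is required for
  -- every finite set.
  simp_rw [Finset.prod_add, Finset.prod_mul_distrib]
  rw [integral_finsetSum]
  · refine Finset.sum_congr rfl fun s _ => ?_
    rw [integral_const_mul, integral_const_mul, h]
  · intro s _
    exact ((integrable_of_norm_le_one (Finset.measurable_fun_prod _ fun n _ => hY n)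
      fun ω => norm_finsetProd_le_one _ fun n _ => hb n ω).const_mul _).const_mul _

lemma integral_prod_batchProd {k : ℕ} {β : Type*} [MeasurableSpace β]
    {V : ℕ → Fin k → ℕ → Ω → β}
    (hV : iIndepFun (fun c : ℕ × Fin k × ℕ => V c.1 c.2.1 c.2.2) P)
    (hm : ∀ n i j, Measurable (V n i j)) (A : Finset ℕ) (x : ℕ → Fin k → ℕ)
    {f : ℕ → Fin k → ℕ → β → ℂ} (hf : ∀ n i j, Measurable (f n i j)) :
    ∫ ω, ∏ n ∈ A, batchProd (x n) (fun i j => f n i j (V n i j ω)) ∂P =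
      ∏ n ∈ A, batchProd (x n) fun i j => ∫ ω, f n i j (V n i j ω) ∂P := by
  have := hV.isProbabilityMeasure
  -- A common bound on the batch sizes: padding with factors 1 turns the nested products into one
  -- product over a fixed box of customer labels, where independence applies directly.
  set M := A.sup fun n => Finset.univ.sup (x n) with hM
  have hle : ∀ n ∈ A, ∀ i, x n i ≤ M := fun n hn i =>
    (Finset.le_sup (f := x n) (Finset.mem_univ i)).trans
      (Finset.le_sup (f := fun n => Finset.univ.sup (x n)) hn)
  have hrw : ∀ u : ℕ → Fin k → ℕ → ℂ, ∏ n ∈ A, batchProd (x n) (u n) =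
      ∏ c ∈ A ×ˢ (Finset.univ : Finset (Fin k)) ×ˢ Finset.range M,
        if c.2.2 < x c.1 c.2.1 then u c.1 c.2.1 c.2.2 else 1 := fun u => by
    rw [Finset.prod_product]
    refine Finset.prod_congr rfl fun n hn => ?_
    rw [Finset.prod_product, batchProd]
    exact Finset.prod_congr rfl fun i _ => prod_range_eq_prod_range_ite (hle n hn i) _
  simp_rw [hrw]
  have key := integral_finsetProd_of_iIndepFun hV (fun c => hm _ _ _)
    (A ×ˢ (Finset.univ : Finset (Fin k)) ×ˢ Finset.range M)
    (f := fun c v => if c.2.2 < x c.1 c.2.1 then f c.1 c.2.1 c.2.2 v else 1) (fun c => by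
      split_ifs
      · exact hf _ _ _
      · exact measurable_const)
  rw [key]
  refine Finset.prod_congr rfl fun c _ => ?_
  split_ifs
  · rfl
  · simp

lemma integral_toMeasure_eq_batchPgf {k : ℕ} (q : PMF (Fin k → ℕ)) {x : Fin k → ℂ}
    (hx : ∀ i, ‖x i‖ ≤ 1) : ∫ n, ∏ i, x i ^ n i ∂q.toMeasure = batchPgf q x := by
  rw [PMF.integral_eq_tsum]
  · rfl
  · refine integrable_of_norm_le_one (measurable_of_countable _) fun n =>
      norm_finsetProd_le_one _ fun i _ => ?_
    rw [norm_pow]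
    exact pow_le_one₀ (norm_nonneg _) (hx i)

lemma norm_batchPgf_le_one {k : ℕ} (q : PMF (Fin k → ℕ)) {x : Fin k → ℂ}
    (hx : ∀ i, ‖x i‖ ≤ 1) : ‖batchPgf q x‖ ≤ 1 := by
  rw [← integral_toMeasure_eq_batchPgf q hx]
  refine (norm_integral_le_of_norm_le_const (C := 1) (Eventually.of_forall fun n =>
      norm_finsetProd_le_one _ fun i _ => ?_)).trans (by simp)
  rw [norm_pow]
  exact pow_le_one₀ (norm_nonneg _) (hx i)

lemma measurable_batchPgf {k : ℕ} (q : PMF (Fin k → ℕ)) {x : ℝ → Fin k → ℂ}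
    (hx : ∀ i, Measurable fun s => x s i) (hb : ∀ s i, ‖x s i‖ ≤ 1) :
    Measurable fun s => batchPgf q (x s) := by
  simp_rw [← fun s => integral_toMeasure_eq_batchPgf q (hb s)]
  have : Measurable (Function.uncurry fun (s : ℝ) (n : Fin k → ℕ) => ∏ i, x s i ^ n i) := by
    refine measurable_from_prod_countable_left fun n => ?_
    exact Finset.measurable_fun_prod _ fun i _ => (hx i).pow_const _
  exact this.stronglyMeasurable.integral_prod_right.measurable

/-- A crude bound, sufficient because Fubini is applied for each fixed `m`. -/
lemma norm_prod_affine_le_two_pow {a b y : ℕ → ℂ} (ha : ∀ n, ‖a n‖ ≤ 1) (hb : ∀ n, ‖b n‖ ≤ 1)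
    (hy : ∀ n, ‖y n‖ ≤ 1) (m : ℕ) : ‖∏ n ∈ Finset.range m, (a n + b n * y n)‖ ≤ 2 ^ m := by
  rw [norm_prod]
  refine (Finset.prod_le_prod (fun _ _ => norm_nonneg _) (g := fun _ => (2 : ℝ))
    fun n _ => ?_).trans (by simp)
  refine (norm_add_le _ _).trans ?_
  rw [norm_mul]
  have := mul_le_one₀ (hb n) (norm_nonneg _) (hy n)
  linarith [ha n]

namespace Data.IsModel

variable {k : ℕ} {lam : ℝ} {q : PMF (Fin k → ℕ)} {ρ : Fin k → Measure ℝ} {S : Data Ω k}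

lemma measurable_arrivals (hS : S.IsModel P lam q ρ) : Measurable fun ω n => S.arrival n ω :=
  measurable_pi_lambda _ hS.arrival_poisson.measurable

lemma measurable_arrival (hS : S.IsModel P lam q ρ) (n : ℕ) : Measurable (S.arrival n) :=
  hS.arrival_poisson.measurable n

lemma measurable_sizes (hS : S.IsModel P lam q ρ) : Measurable fun ω n => S.size n ω :=
  measurable_pi_lambda _ hS.size_measurable

lemma measurable_services (hS : S.IsModel P lam q ρ) :
    Measurable fun ω n i j => S.service n i j ω :=
  measurable_pi_lambda _ fun n => measurable_pi_lambda _ fun i => measurable_pi_lambda _ fun j =>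
    hS.service_measurable n i j

lemma measurable_history (hS : S.IsModel P lam q ρ) : Measurable S.history :=
  hS.measurable_arrivals.prodMk (hS.measurable_sizes.prodMk hS.measurable_services)

variable [IsProbabilityMeasure P]

/-- Expectation over batch sizes and service times of a product over all customers of finitely
many batches. -/
lemma integral_prod_batchProd_service (hS : S.IsModel P lam q ρ) {f : ℕ → Fin k → ℝ → ℂ}
    (hf : ∀ n i, Measurable (f n i)) (hb : ∀ n i x, ‖f n i x‖ ≤ 1) (A : Finset ℕ) :
    ∫ ω, ∏ n ∈ A, batchProd (S.size n ω) (fun i j => f n i (S.service n i j ω)) ∂P =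
      ∏ n ∈ A, batchPgf q fun i => ∫ x, f n i x ∂(ρ i) := by
  have hprob : ∀ i, IsProbabilityMeasure (ρ i) := fun i => by
    rw [← hS.service_law 0 i 0]
    exact Measure.isProbabilityMeasure_map (hS.service_measurable 0 i 0).aemeasurable
  have hv : ∀ n i, ‖∫ x, f n i x ∂(ρ i)‖ ≤ 1 := fun n i =>
    (norm_integral_le_of_norm_le_const (C := 1) (Eventually.of_forall fun x => hb n i x)).trans
      (by simp)
  have h1 := integral_indepFun_eq hS.measurable_sizes hS.measurable_services
    hS.size_service_indep
    (F := fun x y => ∏ n ∈ A, batchProd (x n) (fun i j => f n i (y n i j))) (M := 1)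
    (Finset.measurable_fun_prod _ fun n _ => measurable_batchProd (by fun_prop) fun i j => by
      have := hf n i
      fun_prop)
    (fun x y => norm_finsetProd_le_one _ fun n _ => norm_batchProd_le_one _ fun i j => hb _ _ _)
  have hlaw : ∀ n i j, ∫ ω, f n i (S.service n i j ω) ∂P = ∫ x, f n i x ∂(ρ i) :=
    fun n i j => by
      rw [← hS.service_law n i j, integral_map (hS.service_measurable n i j).aemeasurable
        (hf n i).aestronglyMeasurable]
  -- With the sizes frozen, each customer of type `i` in batch `n` contributes the same mean, hence
  -- a power; averaging this power over the sizes yields `Q`.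
  have h2 : ∀ x : ℕ → Fin k → ℕ,
      ∫ ω, ∏ n ∈ A, batchProd (x n) (fun i j => f n i (S.service n i j ω)) ∂P =
      ∏ n ∈ A, ∏ i, (∫ y, f n i y ∂(ρ i)) ^ x n i := fun x => by
    rw [integral_prod_batchProd hS.service_indep hS.service_measurable A x
      (f := fun n i _ => f n i) (fun n i _ => hf n i)]
    simp_rw [hlaw, batchProd, Finset.prod_const, Finset.card_range]
  rw [h1]
  simp_rw [h2]
  have hpm : ∀ n, Measurable fun x : Fin k → ℕ => ∏ i, (∫ y, f n i y ∂(ρ i)) ^ x i := fun n =>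
    measurable_of_countable _
  rw [integral_finsetProd_of_iIndepFun hS.size_indep hS.size_measurable A hpm]
  refine Finset.prod_congr rfl fun n _ => ?_
  rw [← integral_toMeasure_eq_batchPgf q (hv n), ← hS.size_law n,
    integral_map (hS.size_measurable n).aemeasurable (hpm n).aestronglyMeasurable]

/-- Expectation over batch sizes and service times, given the arrival times. -/
lemma integral_prod_arrival (hS : S.IsModel P lam q ρ) {a b : ℝ → ℂ} {θ : Fin k → ℝ → ℝ → ℂ}
    (ha : Measurable a) (hb : Measurable b) (hθ : ∀ i, Measurable (Function.uncurry (θ i)))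
    (ha1 : ∀ s, ‖a s‖ ≤ 1) (hb1 : ∀ s, ‖b s‖ ≤ 1) (hθ1 : ∀ i s x, ‖θ i s x‖ ≤ 1) (m : ℕ) :
    ∫ ω, ∏ n ∈ Finset.range m, (a (S.arrival n ω) + b (S.arrival n ω) *
      batchProd (S.size n ω) fun i j => θ i (S.arrival n ω) (S.service n i j ω)) ∂P =
    ∫ ω, ∏ n ∈ Finset.range m, (a (S.arrival n ω) + b (S.arrival n ω) *
      batchPgf q fun i => ∫ x, θ i (S.arrival n ω) x ∂(ρ i)) ∂P := by
  have h1 := integral_indepFun_eq hS.measurable_arrivals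
    (hS.measurable_sizes.prodMk hS.measurable_services) hS.arrival_indep
    (F := fun T p => ∏ n ∈ Finset.range m, (a (T n) + b (T n) *
      batchProd (p.1 n) fun i j => θ i (T n) (p.2 n i j))) (M := 2 ^ m)
    (Finset.measurable_fun_prod _ fun n _ => by
      refine (ha.comp (by fun_prop)).add ((hb.comp (by fun_prop)).mul ?_)
      refine measurable_batchProd (by fun_prop) fun i j => ?_
      exact (hθ i).comp (Measurable.prodMk (by fun_prop) (by fun_prop)))
    (fun T p => norm_prod_affine_le_two_pow (fun _ => ha1 _) (fun _ => hb1 _)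
      (fun _ => norm_batchProd_le_one _ fun _ _ => hθ1 _ _ _) m)
  rw [h1]
  refine integral_congr_ae (Eventually.of_forall fun ω => ?_)
  have hsec : ∀ n i, Measurable fun x => θ i (S.arrival n ω) x := fun n i =>
    (hθ i).comp measurable_prodMk_left
  exact integral_prod_affine (P := P)
    (Y := fun n ω' => batchProd (S.size n ω') fun i j =>
      θ i (S.arrival n ω) (S.service n i j ω'))
    (fun n => measurable_batchProd (hS.size_measurable n) fun i j =>
      (hsec n i).comp (hS.service_measurable n i j))
    (fun n ω' => norm_batchProd_le_one _ fun _ _ => hθ1 _ _ _)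
    (fun A => hS.integral_prod_batchProd_service (f := fun n i => θ i (S.arrival n ω)) hsec
      (fun _ _ _ => hθ1 _ _ _) A) _ _ _

/-- The generating functional of the batches marked with their sizes and service times. -/
theorem tendsto_integral_prod (hS : S.IsModel P lam q ρ) (hlam : 0 < lam) {a b : ℝ → ℂ}
    {θ : Fin k → ℝ → ℝ → ℂ} {v : ℝ → Fin k → ℂ} {t : ℝ}
    (ha : Measurable a) (hb : Measurable b) (hθ : ∀ i, Measurable (Function.uncurry (θ i)))
    (ha1 : ∀ s, ‖a s‖ ≤ 1) (hb1 : ∀ s, ‖b s‖ ≤ 1) (hθ1 : ∀ i s x, ‖θ i s x‖ ≤ 1)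
    (hv : ∀ s i, ∫ x, θ i s x ∂(ρ i) = v s i)
    (hab : ∀ s, ‖a s + b s * batchPgf q (v s)‖ ≤ 1)
    (hat : ∀ s, t < s → a s = 1) (hbt : ∀ s, t < s → b s = 0) :
    Tendsto (fun m => ∫ ω, ∏ n ∈ Finset.range m, (a (S.arrival n ω) + b (S.arrival n ω) *
      batchProd (S.size n ω) fun i j => θ i (S.arrival n ω) (S.service n i j ω)) ∂P) atTop
      (𝓝 (Complex.exp (lam * ∫ s in (0 : ℝ)..t, (a s + b s * batchPgf q (v s) - 1)))) := by
  have hprob : ∀ i, IsProbabilityMeasure (ρ i) := fun i => by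
    rw [← hS.service_law 0 i 0]
    exact Measure.isProbabilityMeasure_map (hS.service_measurable 0 i 0).aemeasurable
  have hvb : ∀ s i, ‖v s i‖ ≤ 1 := fun s i => by
    rw [← hv]
    exact (norm_integral_le_of_norm_le_const (C := 1)
      (Eventually.of_forall fun x => hθ1 i s x)).trans (by simp)
  have hvm : ∀ i, Measurable fun s => v s i := fun i => by
    simp_rw [← hv]
    exact (hθ i).stronglyMeasurable.integral_prod_right.measurable
  have hg : Measurable fun s => a s + b s * batchPgf q (v s) :=
    ha.add (hb.mul (measurable_batchPgf q hvm hvb))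
  refine (hS.arrival_poisson.tendsto_integral_prod hlam (t := t) hg hab fun s hs => ?_).congr
    fun m => ?_
  · simp only [hat s hs, hbt s hs, zero_mul, add_zero]
  · rw [hS.integral_prod_arrival ha hb hθ ha1 hb1 hθ1 m]
    simp_rw [hv]


/-- Expectation over the colours, given everything else. -/
lemma integral_prod_colouring (hS : S.IsModel P lam q ρ)
    {red : ℕ → Fin k → ℕ → Ω → Bool}
    {z : Fin k → ℝ} (hred : S.IsColouring P red z) {a b : ℝ → ℂ} {κ : Fin k → ℝ → ℝ → ℂ}
    (ha : Measurable a) (hb : Measurable b) (hκ : ∀ i, Measurable (Function.uncurry (κ i)))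
    (ha1 : ∀ s, ‖a s‖ ≤ 1) (hb1 : ∀ s, ‖b s‖ ≤ 1) (hκ1 : ∀ i s x, ‖κ i s x‖ ≤ 1) (m : ℕ) :
    ∫ ω, ∏ n ∈ Finset.range m, (a (S.arrival n ω) + b (S.arrival n ω) *
      batchProd (S.size n ω) fun i j =>
        if red n i j ω = true then 1 else κ i (S.arrival n ω) (S.service n i j ω)) ∂P =
    ∫ ω, ∏ n ∈ Finset.range m, (a (S.arrival n ω) + b (S.arrival n ω) *
      batchProd (S.size n ω) fun i j =>
        (z i + (1 - z i) * κ i (S.arrival n ω) (S.service n i j ω))) ∂P := by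
  have hredm : Measurable fun ω n i j => red n i j ω :=
    measurable_pi_lambda _ fun n => measurable_pi_lambda _ fun i => measurable_pi_lambda _ fun j =>
      hred.measurable n i j
  have hite : ∀ (c : ℂ), ‖c‖ ≤ 1 → ∀ r : Bool, ‖if r = true then (1 : ℂ) else c‖ ≤ 1 := by
    intro c hc r
    split_ifs <;> simp [hc]
  have h1 := integral_indepFun_eq hS.measurable_history hredm hred.indep_history.symm
    (F := fun h r => ∏ n ∈ Finset.range m, (a (h.1 n) + b (h.1 n) *
      batchProd (h.2.1 n) fun i j =>
        if r n i j = true then 1 else κ i (h.1 n) (h.2.2 n i j))) (M := 2 ^ m)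
    (Finset.measurable_fun_prod _ fun n _ => by
      refine (ha.comp (by fun_prop)).add ((hb.comp (by fun_prop)).mul ?_)
      refine measurable_batchProd (by fun_prop) fun i j => ?_
      refine Measurable.ite ?_ measurable_const
        ((hκ i).comp (Measurable.prodMk (by fun_prop) (by fun_prop)))
      exact measurableSet_eq_fun (by fun_prop) measurable_const)
    (fun T p => norm_prod_affine_le_two_pow (fun _ => ha1 _) (fun _ => hb1 _)
      (fun _ => norm_batchProd_le_one _ fun _ _ => hite _ (hκ1 _ _ _) _) m)
  refine h1.trans ?_
  refine integral_congr_ae (Eventually.of_forall fun ω => ?_)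
  have hset : ∀ n i j, MeasurableSet {ω | red n i j ω = true} := fun n i j =>
    hred.measurable n i j (measurableSet_singleton true)
  have hcol : ∀ n i j (c : ℂ), ∫ ω', (if red n i j ω' = true then (1 : ℂ) else c) ∂P =
      z i + (1 - z i) * c := fun n i j c => by
    have e : ∀ ω', (if red n i j ω' = true then (1 : ℂ) else c) =
        c + {ω | red n i j ω = true}.indicator (fun _ => 1 - c) ω' := fun ω' => by
      by_cases h : red n i j ω' = true
      · rw [indicator_of_mem (by exact h), if_pos h]; ring
      · rw [indicator_of_notMem (by exact h), if_neg h, add_zero]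
    simp_rw [e]
    rw [integral_add (integrable_const _) ((integrable_const _).indicator (hset n i j)),
      integral_indicator_const _ (hset n i j), hred.prob_red, integral_const]
    simp only [probReal_univ, one_smul, Complex.real_smul]
    ring
  refine integral_prod_affine (P := P)
    (Y := fun n ω' => batchProd (S.size n ω) fun i j =>
      if red n i j ω' = true then 1 else κ i (S.arrival n ω) (S.service n i j ω))
    (y := fun n => batchProd (S.size n ω) fun i j =>
        (z i + (1 - z i) * κ i (S.arrival n ω) (S.service n i j ω)))
    (fun n => measurable_batchProd measurable_const fun i j =>
      Measurable.ite (hset n i j) measurable_const measurable_const)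
    (fun n ω' => norm_batchProd_le_one _ fun _ _ => hite _ (hκ1 _ _ _) _)
    (fun A => ?_) _ _ _
  have h2 := integral_prod_batchProd hred.indep hred.measurable A (fun n => S.size n ω)
    (f := fun n i j r => if r = true then 1 else κ i (S.arrival n ω) (S.service n i j ω))
    (fun n i j => measurable_from_top)
  rw [h2]
  simp_rw [hcol]

end Data.IsModel
end BatchQueue

/-! ### From products over batches to generating functions and probabilities -/

namespace BatchQueue

variable {Ω : Type*} {k : ℕ}

/-- Number of type `i` customers satisfying `R` in the batches before `m` which satisfy `good`. -/
def countBefore (good : ℕ → Prop) [∀ n, Decidable (good n)] (x : ℕ → Fin k → ℕ)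
    (R : Fin k → ℕ → ℕ → Prop) [∀ i n j, Decidable (R i n j)] (m : ℕ) (i : Fin k) : ℕ :=
  ∑ n ∈ Finset.range m, ∑ j ∈ Finset.range (x n i), if good n ∧ R i n j then 1 else 0

lemma encard_eq_countBefore {good : ℕ → Prop} [∀ n, Decidable (good n)] (x : ℕ → Fin k → ℕ)
    (R : Fin k → ℕ → ℕ → Prop) [∀ i n j, Decidable (R i n j)] {m : ℕ}
    (hm : ∀ n, m ≤ n → ¬ good n) (i : Fin k) :
    {c : ℕ × ℕ | good c.1 ∧ c.2 < x c.1 i ∧ R i c.1 c.2}.encard =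
      (countBefore good x R m i : ℕ∞) := by
  classical
  set F : Finset (Σ _ : ℕ, ℕ) := ((Finset.range m).sigma fun n => Finset.range (x n i)).filter
    fun c => good c.1 ∧ R i c.1 c.2 with hF
  have h1 : {c : ℕ × ℕ | good c.1 ∧ c.2 < x c.1 i ∧ R i c.1 c.2} =
      Equiv.sigmaEquivProd ℕ ℕ '' (F : Set (Σ _ : ℕ, ℕ)) := by
    ext ⟨n, j⟩
    simp only [mem_ofPred_eq, mem_image, Finset.mem_coe, hF, Finset.mem_filter, Finset.mem_sigma,
      Finset.mem_range, Sigma.exists, Equiv.sigmaEquivProd_apply, Prod.mk.injEq]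
    constructor
    · rintro ⟨hg, hj, hR⟩
      exact ⟨n, j, ⟨⟨not_le.1 fun h => hm n h hg, hj⟩, hg, hR⟩, rfl, rfl⟩
    · rintro ⟨n, j, ⟨⟨-, hj⟩, hg, hR⟩, rfl, rfl⟩
      exact ⟨hg, hj, hR⟩
  rw [h1, (Equiv.sigmaEquivProd ℕ ℕ).injective.encard_image, encard_coe_eq_coe_finsetCard, hF,
    Finset.card_filter, Finset.sum_sigma]
  rfl

/-- A batch that is not good contributes the factor 1, and a good one contributes `z i` for each
counted customer. This identifies the marked functional with a generating function. -/
lemma prod_batchProd_eq_prod_pow (good : ℕ → Prop) [∀ n, Decidable (good n)]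
    (x : ℕ → Fin k → ℕ) (R : Fin k → ℕ → ℕ → Prop) [∀ i n j, Decidable (R i n j)]
    (z : Fin k → ℂ) (m : ℕ) :
    ∏ n ∈ Finset.range m, ((if good n then 0 else 1) + (if good n then 1 else 0) *
      batchProd (x n) fun i j => if R i n j then z i else 1) =
    ∏ i, z i ^ countBefore good x R m i := by
  simp_rw [countBefore, ← Finset.prod_pow_eq_pow_sum]
  rw [Finset.prod_comm]
  refine Finset.prod_congr rfl fun n _ => ?_
  by_cases hg : good n
  · simp only [hg, if_true, zero_add, one_mul, true_and, batchProd]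
    refine Finset.prod_congr rfl fun i _ => Finset.prod_congr rfl fun j _ => ?_
    split_ifs <;> simp
  · simp [hg]

lemma measurable_countBefore [MeasurableSpace Ω] {good : ℕ → Ω → Prop}
    [∀ n ω, Decidable (good n ω)] {x : ℕ → Ω → Fin k → ℕ} {R : Fin k → ℕ → ℕ → Ω → Prop}
    [∀ i n j ω, Decidable (R i n j ω)] (hgood : ∀ n, MeasurableSet {ω | good n ω})
    (hx : ∀ n, Measurable (x n)) (hR : ∀ i n j, MeasurableSet {ω | R i n j ω}) (m : ℕ) :
    Measurable fun ω =>
      countBefore (fun n => good n ω) (fun n => x n ω) (fun i n j => R i n j ω) m := by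
  refine measurable_pi_lambda _ fun i => Finset.measurable_sum _ fun n _ => ?_
  have h : Measurable fun p : Ω × ℕ =>
      ∑ j ∈ Finset.range p.2, if good n p.1 ∧ R i n j p.1 then 1 else 0 :=
    measurable_from_prod_countable_left fun N =>
      Finset.measurable_sum (Finset.range N) fun j _ =>
        Measurable.ite ((hgood n).inter (hR i n j)) measurable_const measurable_const
  exact h.comp (measurable_id.prodMk ((measurable_pi_apply i).comp (hx n)))

variable [MeasurableSpace Ω] {P : Measure Ω}

/-- The series of the generating function of an almost surely finite random vector sums to
the expectation of `∏ z i ^ N i`. -/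
lemma hasSum_pgfTerm [IsProbabilityMeasure P] {N : Ω → Fin k → ℕ∞} {N' : Ω → Fin k → ℕ}
    (hN' : AEMeasurable N' P) (h : ∀ᵐ ω ∂P, ∀ i, N ω i = N' ω i) {z : Fin k → ℂ}
    (hz : ∀ i, ‖z i‖ ≤ 1) : HasSum (pgfTerm P N z) (∫ ω, ∏ i, z i ^ N' ω i ∂P) := by
  set f : (Fin k → ℕ) → ℂ := fun n => ∏ i, z i ^ n i with hf
  have hfm : Measurable f := measurable_of_countable _
  have := Measure.isProbabilityMeasure_map (μ := P) hN'
  have hfb : ∀ n, ‖f n‖ ≤ 1 := fun n => norm_finsetProd_le_one _ fun i _ => by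
    rw [norm_pow]
    exact pow_le_one₀ (norm_nonneg _) (hz i)
  have h1 : ∫ ω, ∏ i, z i ^ N' ω i ∂P = ∫ n, f n ∂(P.map N') :=
    (integral_map hN' hfm.aestronglyMeasurable).symm
  have h2 := hasSum_integral_iUnion (μ := P.map N') (f := f)
    (s := fun n : Fin k → ℕ => {n}) (fun n => measurableSet_singleton n)
    (fun a b hab => by simpa using hab) (integrable_of_norm_le_one hfm hfb).integrableOn
  rw [iUnion_of_singleton, setIntegral_univ] at h2
  rw [h1]
  refine Eq.mpr (congrArg (HasSum · _) (funext fun n => ?_)) h2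
  rw [integral_singleton, pgfTerm, map_measureReal_apply_of_aemeasurable hN'
    (measurableSet_singleton n), Complex.real_smul]
  congr 2
  refine measureReal_congr ?_
  filter_upwards [h] with ω hω
  apply propext
  change (∀ i, N ω i = n i) ↔ N' ω ∈ ({n} : Set (Fin k → ℕ))
  simp [hω, funext_iff]

/-- A generating function is the limit of the expectations of `∏ z i ^ N i`, restricted to the
first `m` batches. -/
lemma hasSum_pgfTerm_of_tendsto [IsProbabilityMeasure P] {good : ℕ → Ω → Prop}
    [∀ n ω, Decidable (good n ω)] {x : ℕ → Ω → Fin k → ℕ} {R : Fin k → ℕ → ℕ → Ω → Prop}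
    [∀ i n j ω, Decidable (R i n j ω)] (hgood : ∀ n, MeasurableSet {ω | good n ω})
    (hx : ∀ n, Measurable (x n)) (hR : ∀ i n j, MeasurableSet {ω | R i n j ω})
    (hfin : ∀ᵐ ω ∂P, ∀ᶠ n in atTop, ¬ good n ω) {z : Fin k → ℂ} (hz : ∀ i, ‖z i‖ ≤ 1) {L : ℂ}
    (hL : Tendsto (fun m => ∫ ω, ∏ n ∈ Finset.range m, ((if good n ω then 0 else 1) +
      (if good n ω then 1 else 0) * batchProd (x n ω) fun i j => if R i n j ω then z i else 1) ∂P)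
      atTop (𝓝 L)) {N : Ω → Fin k → ℕ∞}
    (hN : ∀ ω i, N ω i = {c : ℕ × ℕ | good c.1 ω ∧ c.2 < x c.1 ω i ∧ R i c.1 c.2 ω}.encard) :
    HasSum (pgfTerm P N z) L := by
  set K : ℕ → Ω → Fin k → ℕ := fun m ω =>
    countBefore (fun n => good n ω) (fun n => x n ω) (fun i n j => R i n j ω) m with hK
  have hKm : ∀ m, Measurable (K m) := measurable_countBefore hgood hx hR
  have hev : ∀ᵐ ω ∂P, ∀ᶠ m in atTop, ∀ i, N ω i = K m ω i := by
    filter_upwards [hfin] with ω hω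
    obtain ⟨m, hm⟩ := eventually_atTop.1 hω
    filter_upwards [eventually_ge_atTop m] with m' hm' i
    rw [hN]
    exact encard_eq_countBefore (fun n => x n ω) (fun i n j => R i n j ω)
      (fun n hn => hm n (hm'.trans hn)) i
  -- The count may be infinite, but only on a null set. Measurability of its finite version is
  -- obtained almost everywhere, as the a.s. limit of the counts over the first `m` batches.
  set N' : Ω → Fin k → ℕ := fun ω i => (N ω i).toNat with hN'
  have hev' : ∀ᵐ ω ∂P, ∀ᶠ m in atTop, K m ω = N' ω := by
    filter_upwards [hev] with ω hω
    filter_upwards [hω] with m hm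
    ext i
    simp [hN', hm i]
  have hN'm : AEMeasurable N' P :=
    aemeasurable_of_tendsto_metrizable_ae atTop (fun m => (hKm m).aemeasurable) (by
      filter_upwards [hev'] with ω hω
      exact tendsto_const_nhds.congr' (hω.mono fun m hm => hm.symm))
  have hNN' : ∀ᵐ ω ∂P, ∀ i, N ω i = N' ω i := by
    filter_upwards [hev] with ω hω i
    obtain ⟨m, hm⟩ := hω.exists
    simp [hN', hm i]
  have hlim : Tendsto (fun m => ∫ ω, ∏ i, z i ^ K m ω i ∂P) atTop
      (𝓝 (∫ ω, ∏ i, z i ^ N' ω i ∂P)) := by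
    refine tendsto_integral_of_dominated_convergence (fun _ => 1) (fun m => ?_)
      (integrable_const _) (fun m => Eventually.of_forall fun ω => ?_) ?_
    · exact ((measurable_of_countable fun n : Fin k → ℕ => ∏ i, z i ^ n i).comp
        (hKm m)).aestronglyMeasurable
    · refine norm_finsetProd_le_one _ fun i _ => ?_
      rw [norm_pow]
      exact pow_le_one₀ (norm_nonneg _) (hz i)
    · filter_upwards [hev'] with ω hω
      exact tendsto_const_nhds.congr' (hω.mono fun m hm => by simp only [hm])
  have hLeq : L = ∫ ω, ∏ i, z i ^ N' ω i ∂P := by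
    refine tendsto_nhds_unique hL (hlim.congr fun m => ?_)
    refine integral_congr_ae (Eventually.of_forall fun ω => ?_)
    exact (prod_batchProd_eq_prod_pow (fun n => good n ω) (fun n => x n ω)
      (fun i n j => R i n j ω) z m).symm
  rw [hLeq]
  exact hasSum_pgfTerm hN'm hNN' hz

/-- The probability of an event whose indicator is an almost sure limit of bounded functions. -/
lemma measureReal_eq_of_tendsto [IsProbabilityMeasure P] {f : ℕ → Ω → ℂ} {E : Set Ω}
    (hf : ∀ m, Measurable (f m)) (hb : ∀ m ω, ‖f m ω‖ ≤ 1)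
    (hlim : ∀ᵐ ω ∂P, ∀ᶠ m in atTop, f m ω = E.indicator (fun _ => 1) ω) {L : ℂ}
    (hL : Tendsto (fun m => ∫ ω, f m ω ∂P) atTop (𝓝 L)) : (P.real E : ℂ) = L := by
  have hlim' : ∀ᵐ ω ∂P, Tendsto (fun m => f m ω) atTop (𝓝 (E.indicator (fun _ => 1) ω)) := by
    filter_upwards [hlim] with ω hω
    exact tendsto_const_nhds.congr' (hω.mono fun m hm => hm.symm)
  have hm : AEMeasurable (E.indicator fun _ => (1 : ℂ)) P :=
    aemeasurable_of_tendsto_metrizable_ae atTop (fun m => (hf m).aemeasurable) hlim'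
  -- Measurability of the event is not assumed: it follows, up to null sets, from the a.s. limit.
  have hE : NullMeasurableSet E P := (aemeasurable_indicator_const_iff (1 : ℂ)).1 hm
  have h1 : ∫ ω, E.indicator (fun _ => (1 : ℂ)) ω ∂P = P.real E := by
    rw [integral_indicator₀ hE, setIntegral_const]
    simp
  rw [← h1]
  exact tendsto_nhds_unique (tendsto_integral_of_dominated_convergence (fun _ => 1)
    (fun m => (hf m).aestronglyMeasurable) (integrable_const _)
    (fun m => Eventually.of_forall (hb m)) hlim') hL

end BatchQueue

/-! ### Numbers in service, numbers served, and collective marks -/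

namespace BatchQueue

variable {k : ℕ} {q : PMF (Fin k → ℕ)} {ρ : Fin k → Measure ℝ}

lemma norm_convexCombo_le_one {c : ℝ} (h0 : 0 ≤ c) (h1 : c ≤ 1) {x y : ℂ} (hx : ‖x‖ ≤ 1)
    (hy : ‖y‖ ≤ 1) : ‖(c : ℂ) * x + (1 - (c : ℂ)) * y‖ ≤ 1 := by
  have e : (1 - (c : ℂ)) = ((1 - c : ℝ) : ℂ) := by push_cast; rfl
  refine (norm_add_le _ _).trans ?_
  rw [e, norm_mul, norm_mul, Complex.norm_real, Complex.norm_real, Real.norm_of_nonneg h0,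
    Real.norm_of_nonneg (by linarith)]
  nlinarith [norm_nonneg x, norm_nonneg y]

lemma norm_w_le_one {z : Fin k → ℂ} (hz : ∀ i, ‖z i‖ ≤ 1) (x : ℝ) (i : Fin k) :
    ‖w ρ z x i‖ ≤ 1 := by
  have := norm_convexCombo_le_one (cdf_nonneg (ρ i) x) (cdf_le_one (ρ i) x) (x := 1) (by simp)
    (hz i)
  rwa [mul_one] at this

lemma norm_wServed_le_one {z : Fin k → ℂ} (hz : ∀ i, ‖z i‖ ≤ 1) (x : ℝ) (i : Fin k) :
    ‖wServed ρ z x i‖ ≤ 1 := by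
  have := norm_convexCombo_le_one (cdf_nonneg (ρ i) x) (cdf_le_one (ρ i) x) (hz i)
    (y := 1) (by simp)
  rwa [mul_one] at this

lemma measurable_cdf (μ : Measure ℝ) : Measurable fun x => ((cdf μ x : ℝ) : ℂ) :=
  Complex.measurable_ofReal.comp (monotone_cdf μ).measurable

lemma measurable_batchPgf_w {z : Fin k → ℂ} (hz : ∀ i, ‖z i‖ ≤ 1) :
    Measurable fun x => batchPgf q (w ρ z x) := by
  refine measurable_batchPgf q (fun i => ?_) (norm_w_le_one hz)
  have := measurable_cdf (ρ i)
  unfold w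
  fun_prop

lemma measurable_batchPgf_wServed {z : Fin k → ℂ} (hz : ∀ i, ‖z i‖ ≤ 1) :
    Measurable fun x => batchPgf q (wServed ρ z x) := by
  refine measurable_batchPgf q (fun i => ?_) (norm_wServed_le_one hz)
  have := measurable_cdf (ρ i)
  unfold wServed
  fun_prop

lemma intervalIntegrable_batchPgf_w {z : Fin k → ℂ} (hz : ∀ i, ‖z i‖ ≤ 1) (t : ℝ) :
    IntervalIntegrable (fun s => batchPgf q (w ρ z (t - s))) volume 0 t :=
  intervalIntegrable_of_bound ((measurable_batchPgf_w hz).comp (measurable_const_sub t))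
    (fun _ => norm_batchPgf_le_one q (norm_w_le_one hz _)) 0 t

lemma intervalIntegrable_batchPgf_wServed {z : Fin k → ℂ} (hz : ∀ i, ‖z i‖ ≤ 1) (t : ℝ) :
    IntervalIntegrable (fun s => batchPgf q (wServed ρ z (t - s))) volume 0 t :=
  intervalIntegrable_of_bound ((measurable_batchPgf_wServed hz).comp (measurable_const_sub t))
    (fun _ => norm_batchPgf_le_one q (norm_wServed_le_one hz _)) 0 t

/-- A customer arriving at `s` has left by `t` exactly when the service time is at most `t - s`, an
event of probability `B i (t - s)`. -/
lemma integral_ite_lt_eq_w [∀ i, IsProbabilityMeasure (ρ i)] (z : Fin k → ℂ) (t s : ℝ)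
    (i : Fin k) : ∫ x, (if t < s + x then z i else 1) ∂(ρ i) = w ρ z (t - s) i := by
  have e : ∀ x, (if t < s + x then z i else 1) =
      z i + (Iic (t - s)).indicator (fun _ => 1 - z i) x := fun x => by
    by_cases h : t < s + x
    · rw [if_pos h, indicator_of_notMem (by rw [mem_Iic]; linarith), add_zero]
    · rw [if_neg h, indicator_of_mem (by rw [mem_Iic]; linarith)]
      ring
  simp_rw [e]
  rw [integral_add (integrable_const _) ((integrable_const _).indicator measurableSet_Iic),
    integral_indicator_const _ measurableSet_Iic, integral_const, w, cdf_eq_real]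
  simp only [probReal_univ, one_smul, Complex.real_smul]
  ring

lemma integral_ite_le_eq_wServed [∀ i, IsProbabilityMeasure (ρ i)] (z : Fin k → ℂ) (t s : ℝ)
    (i : Fin k) : ∫ x, (if s + x ≤ t then z i else 1) ∂(ρ i) = wServed ρ z (t - s) i := by
  have e : ∀ x, (if s + x ≤ t then z i else 1) =
      1 + (Iic (t - s)).indicator (fun _ => z i - 1) x := fun x => by
    by_cases h : s + x ≤ t
    · rw [if_pos h, indicator_of_mem (by rw [mem_Iic]; linarith)]
      ring
    · rw [if_neg h, indicator_of_notMem (by rw [mem_Iic]; linarith), add_zero]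
  simp_rw [e]
  rw [integral_add (integrable_const _) ((integrable_const _).indicator measurableSet_Iic),
    integral_indicator_const _ measurableSet_Iic, integral_const, wServed, cdf_eq_real]
  simp only [probReal_univ, one_smul, Complex.real_smul]
  ring

lemma norm_ite_add_ite_mul_le_one (p : Prop) [Decidable p] {y : ℂ} (hy : ‖y‖ ≤ 1) :
    ‖(if p then 0 else 1) + (if p then 1 else 0) * y‖ ≤ 1 := by
  split_ifs <;> simp [hy]

lemma batchProd_ite_zero_one (x : Fin k → ℕ) (p : Fin k → ℕ → Prop)
    [∀ i j, Decidable (p i j)] [Decidable (∀ i, ∀ j < x i, p i j)] :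
    batchProd x (fun i j => if p i j then 1 else 0) = if ∀ i, ∀ j < x i, p i j then 1 else 0 := by
  split_ifs with h
  · exact Finset.prod_eq_one fun i _ => Finset.prod_eq_one fun j hj =>
      if_pos (h i j (Finset.mem_range.1 hj))
  · push Not at h
    obtain ⟨i, j, hj, hp⟩ := h
    exact Finset.prod_eq_zero (Finset.mem_univ i)
      (Finset.prod_eq_zero (Finset.mem_range.2 hj) (if_neg hp))

/-- For arguments in `[0, 1]`, `1 - Q` is an average of numbers in `[0, 1]`; for complex arguments
only the bound 2 would be available. It is needed to use `1 - Q` as the factor `g` of the Poisson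
functional. -/
lemma norm_one_sub_batchPgf_le_one (q : PMF (Fin k → ℕ)) {u : Fin k → ℝ}
    (hu : ∀ i, 0 ≤ u i ∧ u i ≤ 1) : ‖1 - batchPgf q fun i => (u i : ℂ)‖ ≤ 1 := by
  have hu1 : ∀ i, ‖(u i : ℂ)‖ ≤ 1 := fun i => by
    rw [Complex.norm_real, Real.norm_of_nonneg (hu i).1]
    exact (hu i).2
  have hb : ∀ n : Fin k → ℕ, ‖∏ i, (u i : ℂ) ^ n i‖ ≤ 1 := fun n =>
    norm_finsetProd_le_one _ fun i _ => by
      rw [norm_pow]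
      exact pow_le_one₀ (norm_nonneg _) (hu1 i)
  have h1 : 1 - batchPgf q (fun i => (u i : ℂ)) =
      ∫ n : Fin k → ℕ, (1 - ∏ i, (u i : ℂ) ^ n i) ∂q.toMeasure := by
    rw [integral_sub (integrable_const _) (integrable_of_norm_le_one
      (measurable_of_countable _) hb), integral_toMeasure_eq_batchPgf q hu1]
    simp
  rw [h1]
  refine (norm_integral_le_of_norm_le_const (C := 1) (Eventually.of_forall fun n => ?_)).trans
    (by simp)
  have h2 : (1 - ∏ i, (u i : ℂ) ^ n i) = ((1 - ∏ i, u i ^ n i : ℝ) : ℂ) := by push_cast; rfl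
  have h3 : 0 ≤ ∏ i, u i ^ n i := Finset.prod_nonneg fun i _ => pow_nonneg (hu i).1 _
  have h4 : ∏ i, u i ^ n i ≤ 1 :=
    Finset.prod_le_one (fun i _ => pow_nonneg (hu i).1 _) fun i _ => pow_le_one₀ (hu i).1 (hu i).2
  rw [h2, Complex.norm_real, Real.norm_of_nonneg (by linarith)]
  linarith

open Classical in
/-- `1` if batch `n` has no blue customer in service at time `t`, else `0`. -/
noncomputable def Data.noBlue {Ω : Type*} (S : Data Ω k) (red : ℕ → Fin k → ℕ → Ω → Bool)
    (t : ℝ) (n : ℕ)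
    (ω : Ω) : ℂ :=
  batchProd (S.size n ω) fun i j => if red n i j ω = true then 1 else
    if t < S.arrival n ω + S.service n i j ω then 0 else 1

lemma Data.noBlue_eq {Ω : Type*} (S : Data Ω k)
    (red : ℕ → Fin k → ℕ → Ω → Bool) (t : ℝ) (n : ℕ) (ω : Ω)
    [Decidable (∀ i, ∀ j < S.size n ω i, red n i j ω = true ∨
      ¬ t < S.arrival n ω + S.service n i j ω)] :
    S.noBlue red t n ω = if ∀ i, ∀ j < S.size n ω i, red n i j ω = true ∨
      ¬ t < S.arrival n ω + S.service n i j ω then 1 else 0 := by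
  rw [← batchProd_ite_zero_one]
  unfold Data.noBlue
  congr 1
  ext i j
  by_cases h1 : red n i j ω = true <;> by_cases h2 : t < S.arrival n ω + S.service n i j ω <;>
    simp [h1, h2]

variable {Ω : Type*} [MeasurableSpace Ω] {P : Measure Ω} {lam : ℝ} {S : Data Ω k}

namespace Data.IsModel

lemma measurable_noBlue (hS : S.IsModel P lam q ρ) {red : ℕ → Fin k → ℕ → Ω → Bool}
    {z : Fin k → ℝ} (hred : S.IsColouring P red z) (t : ℝ) (n : ℕ) :
    Measurable (S.noBlue red t n) := by
  refine measurable_batchProd (hS.size_measurable n) fun i j => Measurable.ite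
    (hred.measurable n i j (measurableSet_singleton true)) measurable_const
    (Measurable.ite ?_ measurable_const measurable_const)
  exact measurableSet_lt measurable_const
    ((hS.measurable_arrival n).add (hS.service_measurable n i j))

variable [IsProbabilityMeasure P]

/-- The generating functional of the customers of the batches arriving at times in `G` whose
arrival and service times form a pair in `D`. -/
lemma tendsto_integral_prod_indicator (hS : S.IsModel P lam q ρ) (hlam : 0 < lam) {t : ℝ}
    {G : Set ℝ} (hG : MeasurableSet G) (hGt : G ⊆ Iic t) [∀ s, Decidable (s ∈ G)]
    {D : Set (ℝ × ℝ)} (hD : MeasurableSet D) [∀ p, Decidable (p ∈ D)] {z : Fin k → ℂ}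
    (hz : ∀ i, ‖z i‖ ≤ 1) {v : ℝ → Fin k → ℂ} (hvb : ∀ s i, ‖v s i‖ ≤ 1)
    (hv : ∀ s i, ∫ x, (if (s, x) ∈ D then z i else 1) ∂(ρ i) = v s i) :
    Tendsto (fun m => ∫ ω, ∏ n ∈ Finset.range m, ((if S.arrival n ω ∈ G then 0 else 1) +
      (if S.arrival n ω ∈ G then 1 else 0) * batchProd (S.size n ω) fun i j =>
        if (S.arrival n ω, S.service n i j ω) ∈ D then z i else 1) ∂P) atTop
      (𝓝 (Complex.exp (lam * ∫ s in (0 : ℝ)..t,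
        G.indicator (fun s => batchPgf q (v s) - 1) s))) := by
  have hnot : ∀ s, t < s → s ∉ G := fun s hs h => not_le.2 hs (hGt h)
  have h := hS.tendsto_integral_prod hlam (a := fun s => if s ∈ G then 0 else 1)
    (b := fun s => if s ∈ G then 1 else 0) (θ := fun i s x => if (s, x) ∈ D then z i else 1)
    (v := v) (t := t) (Measurable.ite hG measurable_const measurable_const)
    (Measurable.ite hG measurable_const measurable_const)
    (fun i => Measurable.ite hD measurable_const measurable_const)
    (fun s => by split_ifs <;> simp) (fun s => by split_ifs <;> simp)
    (fun i s x => by split_ifs <;> simp [hz i]) hv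
    (fun s => norm_ite_add_ite_mul_le_one _ (norm_batchPgf_le_one q (hvb s)))
    (fun s hs => if_neg (hnot s hs)) (fun s hs => if_neg (hnot s hs))
  convert h using 5
  ext s
  by_cases hs : s ∈ G <;> simp [hs]

lemma integral_indicator_Iic {t : ℝ} (ht : 0 ≤ t) (f : ℝ → ℂ) :
    ∫ s in (0 : ℝ)..t, (Iic t).indicator f s = ∫ s in (0 : ℝ)..t, f s :=
  intervalIntegral.integral_congr fun s hs => by
    rw [uIcc_of_le ht] at hs
    exact indicator_of_mem (mem_Iic.2 hs.2) _

lemma ae_eventually_arrival_not_le (hS : S.IsModel P lam q ρ) (hlam : 0 < lam) (t : ℝ) :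
    ∀ᵐ ω ∂P, ∀ᶠ n in atTop, ¬ S.arrival n ω ≤ t := by
  filter_upwards [hS.arrival_poisson.ae_eventually_lt hlam t] with ω hω
  exact hω.mono fun n hn => not_le.2 hn

theorem hasSum_inService [∀ i, IsProbabilityMeasure (ρ i)]
    (hS : S.IsModel P lam q ρ) (hlam : 0 < lam) {z : Fin k → ℂ}
    (hz : ∀ i, ‖z i‖ ≤ 1) {t : ℝ} (ht : 0 ≤ t) :
    HasSum (pgfTerm P (S.inService t) z)
      (Complex.exp (lam * ∫ s in (0 : ℝ)..t, (batchPgf q (w ρ z (t - s)) - 1))) := by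
  classical
  have hD : MeasurableSet {p : ℝ × ℝ | t < p.1 + p.2} :=
    measurableSet_lt measurable_const (measurable_fst.add measurable_snd)
  -- All arrivals up to `t` are kept, and the weight `z i` goes to pairs (arrival, service) with sum
  -- beyond `t`.
  have h := hS.tendsto_integral_prod_indicator hlam (t := t) measurableSet_Iic subset_rfl hD hz
    (fun s => norm_w_le_one hz (t - s)) (integral_ite_lt_eq_w z t)
  rw [integral_indicator_Iic ht] at h
  exact hasSum_pgfTerm_of_tendsto (R := fun i n j ω => t < S.arrival n ω + S.service n i j ω)
    (fun n => measurableSet_le (hS.measurable_arrival n) measurable_const) hS.size_measurable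
    (fun i n j => measurableSet_lt measurable_const
      ((hS.measurable_arrival n).add (hS.service_measurable n i j)))
    (hS.ae_eventually_arrival_not_le hlam t) hz h fun ω i => rfl

theorem hasSum_served [∀ i, IsProbabilityMeasure (ρ i)]
    (hS : S.IsModel P lam q ρ) (hlam : 0 < lam) {z : Fin k → ℂ}
    (hz : ∀ i, ‖z i‖ ≤ 1) {t : ℝ} (ht : 0 ≤ t) :
    HasSum (pgfTerm P (S.served t) z)
      (Complex.exp (lam * ∫ s in (0 : ℝ)..t, (batchPgf q (wServed ρ z (t - s)) - 1))) := by
  classical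
  have hD : MeasurableSet {p : ℝ × ℝ | p.1 + p.2 ≤ t} :=
    measurableSet_le (measurable_fst.add measurable_snd) measurable_const
  have h := hS.tendsto_integral_prod_indicator hlam (t := t) measurableSet_Iic subset_rfl hD hz
    (fun s => norm_wServed_le_one hz (t - s)) (integral_ite_le_eq_wServed z t)
  rw [integral_indicator_Iic ht] at h
  exact hasSum_pgfTerm_of_tendsto (R := fun i n j ω => S.arrival n ω + S.service n i j ω ≤ t)
    (fun n => measurableSet_le (hS.measurable_arrival n) measurable_const) hS.size_measurable
    (fun i n j => measurableSet_le
      ((hS.measurable_arrival n).add (hS.service_measurable n i j)) measurable_const)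
    (hS.ae_eventually_arrival_not_le hlam t) hz h fun ω i => rfl

section Colouring

variable {red : ℕ → Fin k → ℕ → Ω → Bool} {z : Fin k → ℝ}

-- The collective-marks step: a customer in service passes only if red, with mean `z i`, while a
-- departed one always passes. Hence colours average out to the weights defining the generating
-- function.
open Classical in
lemma integral_prod_noBlue (hS : S.IsModel P lam q ρ) (hred : S.IsColouring P red z) (t : ℝ)
    {a b : ℝ → ℂ} (ha : Measurable a) (hb : Measurable b) (ha1 : ∀ s, ‖a s‖ ≤ 1)
    (hb1 : ∀ s, ‖b s‖ ≤ 1) (m : ℕ) :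
    ∫ ω, ∏ n ∈ Finset.range m, (a (S.arrival n ω) + b (S.arrival n ω) * S.noBlue red t n ω) ∂P =
    ∫ ω, ∏ n ∈ Finset.range m, (a (S.arrival n ω) + b (S.arrival n ω) *
      batchProd (S.size n ω) fun i j =>
        if t < S.arrival n ω + S.service n i j ω then (z i : ℂ) else 1) ∂P := by
  have h := hS.integral_prod_colouring hred (κ := fun _ s x => if t < s + x then 0 else 1) ha hb
    (fun i => Measurable.ite (measurableSet_lt measurable_const
      (measurable_fst.add measurable_snd)) measurable_const measurable_const) ha1 hb1
    (fun i s x => by split_ifs <;> simp) m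
  refine h.trans (integral_congr_ae (Eventually.of_forall fun ω => ?_))
  refine Finset.prod_congr rfl fun n _ => ?_
  congr 3
  ext i j
  split_ifs <;> simp

theorem prob_no_blue [∀ i, IsProbabilityMeasure (ρ i)] (hS : S.IsModel P lam q ρ) (hlam : 0 < lam)
    (hz : ∀ i, 0 ≤ z i ∧ z i ≤ 1) (hred : S.IsColouring P red z) {t : ℝ} (ht : 0 ≤ t) :
    (P.real {ω | ∀ i, ∀ c ∈ S.present t ω i, red c.1 i c.2 ω = true} : ℂ) =
      Complex.exp (lam * ∫ s in (0 : ℝ)..t,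
        (batchPgf q (w ρ (fun i => (z i : ℂ)) (t - s)) - 1)) := by
  classical
  have hz1 : ∀ i, ‖(z i : ℂ)‖ ≤ 1 := fun i => by
    rw [Complex.norm_real, Real.norm_of_nonneg (hz i).1]
    exact (hz i).2
  have hD : MeasurableSet {p : ℝ × ℝ | t < p.1 + p.2} :=
    measurableSet_lt measurable_const (measurable_fst.add measurable_snd)
  have h := hS.tendsto_integral_prod_indicator hlam (t := t) measurableSet_Iic subset_rfl hD hz1
    (fun s => norm_w_le_one hz1 (t - s)) (integral_ite_lt_eq_w _ t)
  rw [integral_indicator_Iic ht] at h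
  have hite : ∀ c d : ℂ, Measurable fun s : ℝ => if s ∈ Iic t then c else d := fun c d =>
    Measurable.ite measurableSet_Iic measurable_const measurable_const
  have hcol := hS.integral_prod_noBlue hred t (hite 0 1) (hite 1 0)
    (fun s => by split_ifs <;> simp) (fun s => by split_ifs <;> simp)
  refine measureReal_eq_of_tendsto (f := fun m ω => ∏ n ∈ Finset.range m,
    ((if S.arrival n ω ∈ Iic t then 0 else 1) +
      (if S.arrival n ω ∈ Iic t then 1 else 0) * S.noBlue red t n ω))
    (fun m => ?_) (fun m ω => ?_) ?_ (h.congr fun m => (hcol m).symm)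
  · exact Finset.measurable_fun_prod _ fun n _ =>
      ((hite 0 1).comp (hS.measurable_arrival n)).add
        (((hite 1 0).comp (hS.measurable_arrival n)).mul (hS.measurable_noBlue hred t n))
  · refine norm_finsetProd_le_one _ fun n _ => norm_ite_add_ite_mul_le_one _ ?_
    rw [S.noBlue_eq]
    split_ifs <;> simp
  -- From `m₀` on all batches arrive after `t` and contribute the factor 1, so the product is
  -- already the indicator of the event.
  · filter_upwards [hS.ae_eventually_arrival_not_le hlam t] with ω hω
    obtain ⟨m₀, hm₀⟩ := eventually_atTop.1 hω
    filter_upwards [eventually_ge_atTop m₀] with m hm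
    by_cases hE : ω ∈ {ω | ∀ i, ∀ c ∈ S.present t ω i, red c.1 i c.2 ω = true}
    · rw [indicator_of_mem hE]
      refine Finset.prod_eq_one fun n _ => ?_
      by_cases hn : S.arrival n ω ≤ t
      · rw [S.noBlue_eq, if_pos fun i j hj => ?_]
        · simp [hn]
        · by_contra hcon
          push Not at hcon
          exact hcon.1 (hE i (n, j) ⟨hn, hj, hcon.2⟩)
      · simp [hn]
    · rw [indicator_of_notMem hE]
      simp only [mem_ofPred_eq, not_forall] at hE
      obtain ⟨i, ⟨n, j⟩, ⟨hn, hj, hs⟩, hr⟩ := hE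
      refine Finset.prod_eq_zero (i := n) (Finset.mem_range.2 ?_) ?_
      · by_contra hmn
        exact hm₀ n (by omega) hn
      · have h0 : S.noBlue red t n ω = 0 := (S.noBlue_eq red t n ω).trans
          (if_neg fun hall => (hall i j hj).elim hr fun h => h hs)
        have hn' : S.arrival n ω ≤ t := hn
        simp [hn', h0]

/-- Here a batch arriving by `t` gets the factor `1 - noBlue`, the indicator that it has a blue
customer in service. Thus `a = 1`, `b = -1` up to `t`, and `g - 1 = -Q`. -/
theorem prob_blue_in_every_batch [∀ i, IsProbabilityMeasure (ρ i)]
    (hS : S.IsModel P lam q ρ) (hlam : 0 < lam)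
    (hz : ∀ i, 0 ≤ z i ∧ z i ≤ 1) (hred : S.IsColouring P red z) {t : ℝ} (ht : 0 ≤ t) :
    (P.real {ω | ∀ n, S.arrival n ω ≤ t →
        ∃ i j, (n, j) ∈ S.present t ω i ∧ red n i j ω = false} : ℂ) =
      Complex.exp (-(lam * ∫ s in (0 : ℝ)..t,
        batchPgf q (w ρ (fun i => (z i : ℂ)) (t - s)))) := by
  classical
  have hz1 : ∀ i, ‖(z i : ℂ)‖ ≤ 1 := fun i => by
    rw [Complex.norm_real, Real.norm_of_nonneg (hz i).1]
    exact (hz i).2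
  have hite : ∀ c d : ℂ, Measurable fun s : ℝ => if s ≤ t then c else d := fun c d =>
    Measurable.ite measurableSet_Iic measurable_const measurable_const
  have hw : ∀ s, ‖1 - batchPgf q (w ρ (fun i => (z i : ℂ)) s)‖ ≤ 1 := fun s => by
    have := norm_one_sub_batchPgf_le_one q
      (u := fun i => cdf (ρ i) s + (1 - cdf (ρ i) s) * z i) fun i => by
        have h0 := cdf_nonneg (ρ i) s
        have h1 := cdf_le_one (ρ i) s
        have h2 := hz i
        constructor
        · nlinarith
        · nlinarith
    push_cast at this
    exact this
  have h := hS.tendsto_integral_prod hlam (a := fun _ => 1)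
    (b := fun s => if s ≤ t then -1 else 0)
    (θ := fun i s x => if t < s + x then (z i : ℂ) else 1)
    (v := fun s => w ρ (fun i => (z i : ℂ)) (t - s)) (t := t) measurable_const (hite _ _)
    (fun i => Measurable.ite (measurableSet_lt measurable_const
      (measurable_fst.add measurable_snd)) measurable_const measurable_const)
    (fun s => by simp) (fun s => by split_ifs <;> simp)
    (fun i s x => by split_ifs; exacts [hz1 i, by simp]) (integral_ite_lt_eq_w _ t)
    (fun s => by
      split_ifs
      · rw [neg_one_mul, ← sub_eq_add_neg]
        exact hw _
      · simp)
    (fun s hs => rfl) (fun s hs => if_neg (not_le.2 hs))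
  have hint : ∫ s in (0 : ℝ)..t, (1 + (if s ≤ t then (-1 : ℂ) else 0) *
      batchPgf q (w ρ (fun i => (z i : ℂ)) (t - s)) - 1) =
      -∫ s in (0 : ℝ)..t, batchPgf q (w ρ (fun i => (z i : ℂ)) (t - s)) := by
    rw [← intervalIntegral.integral_neg]
    refine intervalIntegral.integral_congr fun s hs => ?_
    rw [uIcc_of_le ht] at hs
    simp [hs.2]
  rw [hint, mul_neg] at h
  have hcol := hS.integral_prod_noBlue hred t (measurable_const (a := (1 : ℂ))) (hite (-1) 0)
    (fun s => by simp) (fun s => by split_ifs <;> simp)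
  refine measureReal_eq_of_tendsto (f := fun m ω => ∏ n ∈ Finset.range m,
    (1 + (if S.arrival n ω ≤ t then -1 else 0) * S.noBlue red t n ω))
    (fun m => ?_) (fun m ω => ?_) ?_ (h.congr fun m => (hcol m).symm)
  · exact Finset.measurable_fun_prod _ fun n _ => measurable_const.add
        (((hite (-1) 0).comp (hS.measurable_arrival n)).mul (hS.measurable_noBlue hred t n))
  · refine norm_finsetProd_le_one _ fun n _ => ?_
    rw [S.noBlue_eq]
    split_ifs <;> simp
  · filter_upwards [hS.ae_eventually_arrival_not_le hlam t] with ω hω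
    obtain ⟨m₀, hm₀⟩ := eventually_atTop.1 hω
    filter_upwards [eventually_ge_atTop m₀] with m hm
    by_cases hE : ω ∈ {ω | ∀ n, S.arrival n ω ≤ t →
        ∃ i j, (n, j) ∈ S.present t ω i ∧ red n i j ω = false}
    · rw [indicator_of_mem hE]
      refine Finset.prod_eq_one fun n _ => ?_
      by_cases hn : S.arrival n ω ≤ t
      · obtain ⟨i, j, ⟨-, hj, hs⟩, hr⟩ := hE n hn
        have h0 : S.noBlue red t n ω = 0 := (S.noBlue_eq red t n ω).trans
          (if_neg fun hall => (hall i j hj).elim (by simp [hr]) fun h => h hs)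
        simp [h0]
      · simp [hn]
    · rw [indicator_of_notMem hE]
      simp only [mem_ofPred_eq, not_forall] at hE
      obtain ⟨n, hn, hno⟩ := hE
      refine Finset.prod_eq_zero (i := n) (Finset.mem_range.2 ?_) ?_
      · by_contra hmn
        exact hm₀ n (by omega) hn
      · rw [S.noBlue_eq, if_pos fun i j hj => ?_]
        · simp [hn]
        · by_contra hcon
          push Not at hcon
          exact hno ⟨i, j, ⟨hn, hj, hcon.2⟩, by simpa using hcon.1⟩

end Colouring

end Data.IsModel
end BatchQueue

/-! ### Catastrophes: the age process and conditioning on catastrophe times -/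

namespace BatchQueue

section Age

/-- Time elapsed at `t` since the last of the times `c m` in `[0, t]`, and `t` if there is none. -/
noncomputable def age (t : ℝ) (c : ℕ → ℝ) : ℝ :=
  ⨅ m, if 0 ≤ c m ∧ c m ≤ t then t - c m else t

variable {t : ℝ} {c : ℕ → ℝ}

lemma age_term_nonneg (ht : 0 ≤ t) (m : ℕ) :
    0 ≤ if 0 ≤ c m ∧ c m ≤ t then t - c m else t := by
  split_ifs with h
  · linarith [h.2]
  · exact ht

lemma bddBelow_age (ht : 0 ≤ t) :
    BddBelow (range fun m => if 0 ≤ c m ∧ c m ≤ t then t - c m else t) :=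
  ⟨0, by rintro _ ⟨m, rfl⟩; exact age_term_nonneg ht m⟩

lemma age_nonneg (ht : 0 ≤ t) : 0 ≤ age t c := le_ciInf (age_term_nonneg ht)

lemma age_le (ht : 0 ≤ t) : age t c ≤ t := by
  refine (ciInf_le (bddBelow_age ht) 0).trans ?_
  split_ifs with h
  · linarith [h.1]
  · exact le_rfl

/-- Because `u ≤ t`, times in `(t - u, t]` are positive, so the restriction `0 ≤ c m` in `age` loses
none of them. -/
lemma le_age_iff (ht : 0 ≤ t) {u : ℝ} (hu : u ≤ t) :
    u ≤ age t c ↔ ∀ m, ¬ (t - u < c m ∧ c m ≤ t) := by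
  rw [age, le_ciInf_iff (bddBelow_age ht)]
  refine forall_congr' fun m => ?_
  split_ifs with h
  · constructor
    · intro h1 h2
      linarith [h2.1]
    · intro h1
      by_contra h2
      exact h1 ⟨by linarith, h.2⟩
  · exact ⟨fun _ h2 => h ⟨by linarith [h2.1], h2.2⟩, fun _ => hu⟩

lemma measurable_age (t : ℝ) : Measurable (age t) := by
  refine Measurable.iInf fun m => Measurable.ite ?_ (by fun_prop) measurable_const
  exact (measurableSet_le measurable_const (measurable_pi_apply m)).inter
    (measurableSet_le (measurable_pi_apply m) measurable_const)

/-- Arrival times up to `t` which are not followed by one of the times `c m` up to `t`. -/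
def survivors (t : ℝ) (c : ℕ → ℝ) : Set ℝ := {s | s ≤ t ∧ ∀ m, ¬ (s ≤ c m ∧ c m ≤ t)}

lemma measurableSet_survivors_uncurry (t : ℝ) :
    MeasurableSet {p : (ℕ → ℝ) × ℝ | p.2 ∈ survivors t p.1} := by
  have h : {p : (ℕ → ℝ) × ℝ | p.2 ∈ survivors t p.1} =
      {p | p.2 ≤ t} ∩ ⋂ m, ({p | p.2 ≤ p.1 m} ∩ {p | p.1 m ≤ t})ᶜ := by
    ext p
    simp [survivors]
  have hm : ∀ m, Measurable fun p : (ℕ → ℝ) × ℝ => p.1 m := fun m =>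
    (measurable_pi_apply m).comp measurable_fst
  rw [h]
  exact (measurableSet_le measurable_snd measurable_const).inter
    (MeasurableSet.iInter fun m => ((measurableSet_le measurable_snd (hm m)).inter
      (measurableSet_le (hm m) measurable_const)).compl)

lemma measurableSet_survivors (t : ℝ) (c : ℕ → ℝ) : MeasurableSet (survivors t c) :=
  (measurableSet_survivors_uncurry t).preimage (measurable_prodMk_left (x := c))

/-- Looking back from `t`, the arrival time `t - r` survives for `r < age` and does not for `age < r
≤ t`. For an arbitrary sequence `c` the infimum need not be attained, so the endpoint is left out as
a null set. -/
lemma integral_survivors (ht : 0 ≤ t) {h : ℝ → ℂ} (hh : Measurable h) {M : ℝ}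
    (hM : ∀ x, ‖h x‖ ≤ M) :
    ∫ s in (0 : ℝ)..t, (survivors t c).indicator (fun s => h (t - s)) s =
      ∫ r in (0 : ℝ)..age t c, h r := by
  classical
  set φ : ℝ → ℂ := fun r => (survivors t c).indicator (fun s => h (t - s)) (t - r) with hφ
  have hφm : Measurable φ :=
    ((hh.comp (measurable_const_sub t)).indicator (measurableSet_survivors t c)).comp
      (measurable_const_sub t)
  have hφM : ∀ r, ‖φ r‖ ≤ M := fun r =>
    (norm_indicator_le_norm_self _ _).trans (hM _)
  have hi := intervalIntegrable_of_bound hφm hφM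
  have e1 : ∫ s in (0 : ℝ)..t, (survivors t c).indicator (fun s => h (t - s)) s =
      ∫ r in (0 : ℝ)..t, φ r := by
    have := intervalIntegral.integral_comp_sub_left (a := 0) (b := t)
      ((survivors t c).indicator fun s => h (t - s)) t
    rw [sub_self, sub_zero] at this
    exact this.symm
  have hU0 := age_nonneg (c := c) ht
  have hUt := age_le (c := c) ht
  have e2 : ∫ r in (0 : ℝ)..age t c, φ r = ∫ r in (0 : ℝ)..age t c, h r := by
    refine intervalIntegral.integral_congr_ae ?_
    filter_upwards [Measure.ae_ne volume (age t c)] with r hne hr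
    rw [uIoc_of_le hU0] at hr
    have hlt : r < age t c := lt_of_le_of_ne hr.2 hne
    have hmem : t - r ∈ survivors t c := by
      refine ⟨by linarith [hr.1], fun m hm => ?_⟩
      have := ciInf_le (bddBelow_age (c := c) ht) m
      rw [if_pos ⟨by linarith [hm.1], hm.2⟩] at this
      change age t c ≤ _ at this
      linarith [hm.1]
    simp only [hφ]
    rw [indicator_of_mem hmem, sub_sub_cancel]
  have e3 : ∫ r in age t c..t, φ r = 0 := by
    rw [← intervalIntegral.integral_zero (E := ℂ) (μ := volume) (a := age t c) (b := t)]
    refine intervalIntegral.integral_congr_ae (Eventually.of_forall fun r hr => ?_)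
    rw [uIoc_of_le hUt] at hr
    obtain ⟨m, hm⟩ := exists_lt_of_ciInf_lt (show (⨅ m, _) < r from hr.1)
    refine indicator_of_notMem (fun hmem => ?_) _
    split_ifs at hm with hc
    · exact hmem.2 m ⟨by linarith, hc.2⟩
    · linarith [hr.2]
  rw [e1, ← intervalIntegral.integral_add_adjacent_intervals (hi 0 (age t c)) (hi (age t c) t),
    e2, e3, add_zero]

end Age

lemma expMeasure_Ici {r : ℝ} (hr : 0 < r) {u : ℝ} (hu : 0 ≤ u) :
    (expMeasure r).real (Ici u) = Real.exp (-(r * u)) := by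
  have := isProbabilityMeasure_expMeasure hr
  have h0 : expMeasure r {u} = 0 :=
    (withDensity_absolutelyContinuous _ _) Real.volume_singleton
  have h1 : (expMeasure r).real (Ici u) = (expMeasure r).real (Ioi u) := by
    refine measureReal_congr ?_
    exact (Ioi_ae_eq_Ici' h0).symm
  have h2 := cdf_expMeasure_eq hr u
  rw [cdf_eq_real, if_pos hu] at h2
  rw [h1, ← compl_Iic, probReal_compl_eq_one_sub measurableSet_Iic, h2]
  ring

variable {Ω : Type*} [MeasurableSpace Ω] {P : Measure Ω}

namespace IsPoissonProcess

variable {C : ℕ → Ω → ℝ} {nu : ℝ}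

lemma measurable_age (h : IsPoissonProcess P C nu) (t : ℝ) :
    Measurable fun ω => age t fun m => C m ω :=
  (BatchQueue.measurable_age t).comp (measurable_pi_lambda _ h.measurable)

variable [IsProbabilityMeasure P]

/-- The age is at least `u` when no event falls in `(t - u, t]`; this void probability is the
Poisson functional of the indicator of the complement of that interval. -/
lemma prob_le_age (h : IsPoissonProcess P C nu) (hnu : 0 < nu) {t u : ℝ} (hu : 0 ≤ u)
    (hut : u ≤ t) : P.real {ω | u ≤ age t fun m => C m ω} = Real.exp (-(nu * u)) := by
  classical
  have ht : 0 ≤ t := hu.trans hut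
  set g : ℝ → ℂ := fun s => if s ∈ Ioc (t - u) t then 0 else 1 with hg
  have hgm : Measurable g := Measurable.ite measurableSet_Ioc measurable_const measurable_const
  have hgb : ∀ s, ‖g s‖ ≤ 1 := fun s => by simp only [hg]; split_ifs <;> simp
  have hlim := h.tendsto_integral_prod hnu (t := t) hgm hgb fun s hs =>
    if_neg fun hmem => not_le.2 hs hmem.2
  have hint : ∫ s in (0 : ℝ)..t, (g s - 1) = -u := by
    have e : ∀ s, g s - 1 = (Ioc (t - u) t).indicator (fun _ => (-1 : ℂ)) s := fun s => by
      by_cases hs : s ∈ Ioc (t - u) t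
      · rw [indicator_of_mem hs]; simp only [hg, if_pos hs]; ring
      · rw [indicator_of_notMem hs]; simp only [hg, if_neg hs]; ring
    simp_rw [e]
    rw [intervalIntegral.integral_of_le ht, setIntegral_indicator measurableSet_Ioc,
      Ioc_inter_Ioc, setIntegral_const]
    have h1 : max 0 (t - u) = t - u := max_eq_right (by linarith)
    rw [h1, min_self, measureReal_def, Real.volume_Ioc, ENNReal.toReal_ofReal (by linarith)]
    simp
  rw [hint] at hlim
  have key := measureReal_eq_of_tendsto (E := {ω | u ≤ age t fun m => C m ω})
    (f := fun m ω => ∏ n ∈ Finset.range m, g (C n ω))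
    (fun m => Finset.measurable_fun_prod _ fun n _ => hgm.comp (h.measurable n))
    (fun m ω => norm_finsetProd_le_one _ fun n _ => hgb _) (by
      filter_upwards [h.ae_eventually_lt hnu t] with ω hω
      obtain ⟨m₀, hm₀⟩ := eventually_atTop.1 hω
      filter_upwards [eventually_ge_atTop m₀] with m hm
      by_cases hE : u ≤ age t fun m => C m ω
      · rw [indicator_of_mem (by exact hE)]
        exact Finset.prod_eq_one fun n _ => if_neg ((le_age_iff ht hut).1 hE n)
      · rw [indicator_of_notMem (by exact hE)]
        rw [le_age_iff ht hut] at hE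
        push Not at hE
        obtain ⟨n, hn⟩ := hE
        refine Finset.prod_eq_zero (i := n) (Finset.mem_range.2 ?_) (if_pos hn)
        by_contra hmn
        exact not_le.2 (hm₀ n (by omega)) hn.2) hlim
  rw [← Complex.ofReal_inj, key]
  push_cast
  congr 1
  ring

/-- Both laws have the same upper tail: 1 for `u ≤ 0`, `exp (-nu u)` for `0 ≤ u ≤ t`, and 0 beyond
`t`. -/
lemma map_age (h : IsPoissonProcess P C nu) (hnu : 0 < nu) {t : ℝ} (ht : 0 ≤ t) :
    P.map (fun ω => age t fun m => C m ω) = (expMeasure nu).map fun x => min t x := by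
  have := isProbabilityMeasure_expMeasure hnu
  have hm := h.measurable_age t
  have hmin : Measurable fun x : ℝ => min t x := measurable_const.min measurable_id
  have := Measure.isProbabilityMeasure_map (μ := P) hm.aemeasurable
  refine Measure.ext_of_Ici _ _ fun u => ?_
  rw [Measure.map_apply hm measurableSet_Ici, Measure.map_apply hmin measurableSet_Ici]
  rcases lt_or_ge t u with htu | hut
  · have e1 : (fun ω => age t fun m => C m ω) ⁻¹' Ici u = ∅ := by
      ext ω
      simpa using (age_le ht).trans_lt htu
    have e2 : (fun x : ℝ => min t x) ⁻¹' Ici u = ∅ := by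
      ext x
      simp [htu]
    rw [e1, e2, measure_empty, measure_empty]
  have e2 : (fun x : ℝ => min t x) ⁻¹' Ici u = Ici u := by
    ext x
    simp [hut]
  rw [e2]
  rcases le_total u 0 with hu | hu
  · have e1 : (fun ω => age t fun m => C m ω) ⁻¹' Ici u = univ := by
      ext ω
      simpa using hu.trans (age_nonneg ht)
    have e3 : expMeasure nu (Ici 0) = 1 := by
      have := expMeasure_Ici hnu le_rfl
      rw [mul_zero, neg_zero, Real.exp_zero, measureReal_def] at this
      rwa [ENNReal.toReal_eq_one_iff] at this
    rw [e1, measure_univ]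
    exact le_antisymm (e3.symm.le.trans (measure_mono (Ici_subset_Ici.2 hu))) prob_le_one
  · have h1 := h.prob_le_age hnu hu hut
    rw [← expMeasure_Ici hnu hu] at h1
    exact (measureReal_eq_measureReal_iff).1 h1

/-- Splitting the exponential law at `t`, the mass `exp (-nu t)` above `t` sits at the value `t`,
and below `t` the density remains. The bound on `Ψ` is asked only on `[0, ∞)`, where `servicePgf`
satisfies it. -/
lemma integral_comp_age (h : IsPoissonProcess P C nu) (hnu : 0 < nu) {t : ℝ} (ht : 0 ≤ t)
    {Ψ : ℝ → ℂ} (hΨ : Measurable Ψ) (hΨb : ∀ x, 0 ≤ x → ‖Ψ x‖ ≤ 1) :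
    ∫ ω, Ψ (age t fun m => C m ω) ∂P =
      Ψ t * Complex.exp (-nu * t) + nu * ∫ x in (0 : ℝ)..t, Ψ x * Complex.exp (-nu * x) := by
  have hmin : Measurable fun x : ℝ => min t x := measurable_const.min measurable_id
  have hexp : IntegrableOn (fun x : ℝ => nu * Complex.exp (-(nu * x))) (Ioi 0) := by
    refine Integrable.mono' ((exp_neg_integrableOn_Ioi 0 hnu).const_mul nu)
      (Measurable.aestronglyMeasurable (by fun_prop)) (Eventually.of_forall fun x => ?_)
    rw [norm_mul, Complex.norm_exp, Complex.norm_real, Real.norm_of_nonneg hnu.le]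
    simp
  have hint : IntegrableOn (fun x : ℝ => nu * Complex.exp (-(nu * x)) * Ψ (min t x)) (Ioi 0) := by
    refine hexp.norm.mono' (Measurable.aestronglyMeasurable (by
      have := hΨ.comp hmin
      simp only [Function.comp_def] at this
      fun_prop)) ((ae_restrict_iff' measurableSet_Ioi).2 (Eventually.of_forall fun x hx => ?_))
    rw [norm_mul]
    exact mul_le_of_le_one_right (norm_nonneg _) (hΨb _ (le_min ht (le_of_lt hx)))
  rw [← integral_map (h.measurable_age t).aemeasurable hΨ.aestronglyMeasurable,
    h.map_age hnu ht, integral_map hmin.aemeasurable hΨ.aestronglyMeasurable,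
    integral_expMeasure hnu, ← Ioc_union_Ioi_eq_Ioi ht,
    setIntegral_union Ioc_disjoint_Ioi_same measurableSet_Ioi
      (hint.mono_set Ioc_subset_Ioi_self) (hint.mono_set (Ioi_subset_Ioi ht)), add_comm]
  congr 1
  · have e : ∫ x in Ioi t, (nu * Complex.exp (-(nu * x)) * Ψ (min t x)) =
        ∫ x in Ioi t, ((nu * Real.exp (-nu * x) : ℝ) : ℂ) * Ψ t := by
      refine setIntegral_congr_fun measurableSet_Ioi fun x hx => ?_
      have hx' : t ≤ x := (mem_Ioi.1 hx).le
      simp only [min_eq_left hx']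
      push_cast
      rw [neg_mul]
    rw [e, integral_mul_const, integral_complex_ofReal, integral_const_mul,
      integral_exp_mul_Ioi (by linarith), mul_comm]
    congr 1
    have : (nu : ℂ) ≠ 0 := by exact_mod_cast hnu.ne'
    push_cast
    field_simp
  · rw [← intervalIntegral.integral_of_le ht, ← intervalIntegral.integral_const_mul]
    refine intervalIntegral.integral_congr fun x hx => ?_
    rw [uIcc_of_le ht] at hx
    simp only [min_eq_right hx.2, neg_mul]
    ring

end IsPoissonProcess

/-- Passage to the limit in a conditional expectation given one of two independent variables. -/
lemma tendsto_integral_of_indepFun [IsProbabilityMeasure P] {α β : Type*} [MeasurableSpace α]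
    [MeasurableSpace β] {X : Ω → α} {Y : Ω → β} (hX : Measurable X) (hY : Measurable Y)
    (h : IndepFun X Y P) {F : ℕ → α → β → ℂ} (hF : ∀ m, Measurable (Function.uncurry (F m)))
    (hb : ∀ m x y, ‖F m x y‖ ≤ 1) {L : α → ℂ}
    (hL : ∀ x, Tendsto (fun m => ∫ ω, F m x (Y ω) ∂P) atTop (𝓝 (L x))) :
    Tendsto (fun m => ∫ ω, F m (X ω) (Y ω) ∂P) atTop (𝓝 (∫ ω, L (X ω) ∂P)) := by
  simp_rw [fun m => integral_indepFun_eq hX hY h (hF m) (hb m)]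
  refine tendsto_integral_of_dominated_convergence (fun _ => 1) (fun m => ?_)
    (integrable_const _) (fun m => Eventually.of_forall fun ω => ?_)
    (Eventually.of_forall fun ω => hL _)
  · have hm : Measurable (Function.uncurry fun x ω => F m x (Y ω)) :=
      (hF m).comp (measurable_fst.prodMk (hY.comp measurable_snd))
    exact (hm.stronglyMeasurable.integral_prod_right.measurable.comp hX).aestronglyMeasurable
  · exact (norm_integral_le_of_norm_le_const (C := 1)
      (Eventually.of_forall fun ω' => hb _ _ _)).trans (by simp)

variable [IsProbabilityMeasure P] {k : ℕ} {q : PMF (Fin k → ℕ)} {ρ : Fin k → Measure ℝ}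
  {lam : ℝ} {S : Data Ω k}

/-- The generating function `P(z, t)` of the numbers in service, as an explicit function of `t`. -/
noncomputable def servicePgf (lam : ℝ) (q : PMF (Fin k → ℕ)) (ρ : Fin k → Measure ℝ)
    (z : Fin k → ℂ) (t : ℝ) : ℂ :=
  Complex.exp (lam * ∫ r in (0 : ℝ)..t, (batchPgf q (w ρ z r) - 1))

section ServicePgf

variable {z : Fin k → ℂ}

lemma continuous_servicePgf (hz : ∀ i, ‖z i‖ ≤ 1) : Continuous (servicePgf lam q ρ z) := by
  have h := (lipschitzWith_primitive ((measurable_batchPgf_w (q := q) (ρ := ρ) hz).sub_const 1)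
    (norm_sub_one_le fun s => norm_batchPgf_le_one q (norm_w_le_one hz s))).continuous
  unfold servicePgf
  fun_prop

lemma norm_servicePgf_le_one (hlam : 0 < lam) (hz : ∀ i, ‖z i‖ ≤ 1) {t : ℝ} (ht : 0 ≤ t) :
    ‖servicePgf lam q ρ z t‖ ≤ 1 :=
  norm_poissonFactor_le_of_le hlam.le (measurable_batchPgf_w hz)
    (fun s => norm_batchPgf_le_one q (norm_w_le_one hz s)) ht

lemma exp_integral_eq_servicePgf (z : Fin k → ℂ) (t : ℝ) :
    Complex.exp (lam * ∫ s in (0 : ℝ)..t, (batchPgf q (w ρ z (t - s)) - 1)) =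
      servicePgf lam q ρ z t := by
  rw [servicePgf, intervalIntegral.integral_comp_sub_left (fun r => batchPgf q (w ρ z r) - 1) t,
    sub_self, sub_zero]

end ServicePgf

theorem Data.IsModel.pgf_inService [∀ i, IsProbabilityMeasure (ρ i)] (hS : S.IsModel P lam q ρ)
    (hlam : 0 < lam) {z : Fin k → ℂ} (hz : ∀ i, ‖z i‖ ≤ 1) {t : ℝ} (ht : 0 ≤ t) :
    pgf P (S.inService t) z = servicePgf lam q ρ z t := by
  rw [← exp_integral_eq_servicePgf]
  exact (hS.hasSum_inService hlam hz ht).tsum_eq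

/-- Conditioning on the catastrophe times makes the set of surviving arrival times deterministic.
The case without catastrophes then applies with that set in place of `(-∞, t]`, and the result is
averaged over the age. -/
theorem Data.IsModel.hasSum_inServiceCat [∀ i, IsProbabilityMeasure (ρ i)]
    (hS : S.IsModel P lam q ρ) (hlam : 0 < lam) {nu : ℝ} (hnu : 0 < nu) {C : ℕ → Ω → ℝ}
    (hC : S.IsCatastrophes P C nu) {z : Fin k → ℂ} (hz : ∀ i, ‖z i‖ ≤ 1) {t : ℝ} (ht : 0 ≤ t) :
    HasSum (pgfTerm P (S.inServiceCat C t) z)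
      (servicePgf lam q ρ z t * Complex.exp (-nu * t) +
        nu * ∫ x in (0 : ℝ)..t, servicePgf lam q ρ z x * Complex.exp (-nu * x)) := by
  classical
  have hD : MeasurableSet {p : ℝ × ℝ | t < p.1 + p.2} :=
    measurableSet_lt measurable_const (measurable_fst.add measurable_snd)
  have hCm : Measurable fun ω m => C m ω := measurable_pi_lambda _ hC.poisson.measurable
  have hQm := (measurable_batchPgf_w (q := q) (ρ := ρ) hz).sub_const 1
  have hQb : ∀ s, ‖batchPgf q (w ρ z s) - 1‖ ≤ (2 : NNReal) :=
    norm_sub_one_le fun s => norm_batchPgf_le_one q (norm_w_le_one hz s)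
  set F : ℕ → (ℕ → ℝ) → (ℕ → ℝ) × (ℕ → Fin k → ℕ) × (ℕ → Fin k → ℕ → ℝ) → ℂ :=
    fun m c h => ∏ n ∈ Finset.range m, ((if h.1 n ∈ survivors t c then 0 else 1) +
      (if h.1 n ∈ survivors t c then 1 else 0) * batchProd (h.2.1 n) fun i j =>
        if t < h.1 n + h.2.2 n i j then z i else 1) with hF
  have hFb : ∀ m c h, ‖F m c h‖ ≤ 1 := fun m c h => norm_finsetProd_le_one _ fun n _ =>
    norm_ite_add_ite_mul_le_one _ (norm_batchProd_le_one _ fun i j => by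
      split_ifs
      · exact hz i
      · simp)
  have hsurv : ∀ n, MeasurableSet {p : (ℕ → ℝ) × (ℕ → ℝ) × (ℕ → Fin k → ℕ) ×
      (ℕ → Fin k → ℕ → ℝ) | p.2.1 n ∈ survivors t p.1} := fun n =>
    (measurableSet_survivors_uncurry t).preimage
      (Measurable.prodMk measurable_fst (by fun_prop) :
        Measurable fun p : (ℕ → ℝ) × (ℕ → ℝ) × (ℕ → Fin k → ℕ) ×
      (ℕ → Fin k → ℕ → ℝ) => (p.1, p.2.1 n))
  have hFm : ∀ m, Measurable (Function.uncurry (F m)) := fun m =>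
    Finset.measurable_fun_prod _ fun n _ =>
      (Measurable.ite (hsurv n) measurable_const measurable_const).add
        ((Measurable.ite (hsurv n) measurable_const measurable_const).mul
          (measurable_batchProd (by fun_prop) fun i j =>
            Measurable.ite (measurableSet_lt measurable_const (by fun_prop))
              measurable_const measurable_const))
  have hcond : ∀ c : ℕ → ℝ, Tendsto (fun m => ∫ ω, F m c (S.history ω) ∂P) atTop
      (𝓝 (servicePgf lam q ρ z (age t c))) := fun c => by
    have h := hS.tendsto_integral_prod_indicator hlam (t := t) (measurableSet_survivors t c)
      (fun s hs => hs.1) hD hz (fun s => norm_w_le_one hz (t - s)) (integral_ite_lt_eq_w z t)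
    rw [integral_survivors (h := fun s => batchPgf q (w ρ z s) - 1) ht hQm hQb] at h
    exact h
  have hlim : Tendsto (fun m => ∫ ω, F m (fun m => C m ω) (S.history ω) ∂P) atTop
      (𝓝 (∫ ω, servicePgf lam q ρ z (age t fun m => C m ω) ∂P)) :=
    tendsto_integral_of_indepFun hCm hS.measurable_history hC.indep hFm hFb hcond
  rw [hC.poisson.integral_comp_age hnu ht (continuous_servicePgf hz).measurable
    fun x hx => norm_servicePgf_le_one hlam hz hx] at hlim
  refine hasSum_pgfTerm_of_tendsto
    (good := fun n ω => S.arrival n ω ∈ survivors t fun m => C m ω)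
    (R := fun i n j ω => t < S.arrival n ω + S.service n i j ω)
    (fun n => ?_) hS.size_measurable
    (fun i n j => measurableSet_lt measurable_const
      ((hS.measurable_arrival n).add (hS.service_measurable n i j)))
    ?_ hz hlim fun ω i => ?_
  · exact (measurableSet_survivors_uncurry t).preimage (hCm.prodMk (hS.measurable_arrival n))
  · filter_upwards [hS.ae_eventually_arrival_not_le hlam t] with ω hω
    exact hω.mono fun n hn hmem => hn hmem.1
  · unfold Data.inServiceCat
    congr 1
    ext c
    simp only [Data.present, survivors, mem_ofPred_eq]
    tauto

end BatchQueue

/-! ### Laplace transforms -/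

namespace BatchQueue

section Laplace

variable {h : ℝ → ℂ} {nu : ℝ} {s : ℂ}

lemma norm_exp_neg_mul (s : ℂ) (t : ℝ) : ‖Complex.exp (-s * t)‖ = Real.exp (-s.re * t) := by
  rw [Complex.norm_exp]
  simp

lemma laplaceConverges_of_bounded {f : ℝ → ℂ} (hf : Continuous f) {M : ℝ}
    (hM : ∀ t, 0 ≤ t → ‖f t‖ ≤ M) (hs : 0 < s.re) : LaplaceConverges f s := by
  refine Integrable.mono' ((exp_neg_integrableOn_Ioi 0 hs).mul_const M)
    (Continuous.aestronglyMeasurable (by fun_prop))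
    ((ae_restrict_iff' measurableSet_Ioi).2 (Eventually.of_forall fun t ht => ?_))
  rw [norm_mul, norm_exp_neg_mul]
  exact mul_le_mul_of_nonneg_left (hM t (le_of_lt ht)) (Real.exp_pos _).le

lemma norm_primitive_le (hnu : 0 < nu) (hh : Continuous h)
    (hb : ∀ t, 0 ≤ t → ‖h t‖ ≤ Real.exp (-nu * t)) {t : ℝ} (ht : 0 ≤ t) :
    ‖∫ x in (0 : ℝ)..t, h x‖ ≤ 1 / nu := by
  have hexp := exp_neg_integrableOn_Ioi 0 hnu
  rw [intervalIntegral.integral_of_le ht]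
  refine (norm_integral_le_integral_norm _).trans ?_
  have h1 : ∫ x in Ioc 0 t, ‖h x‖ ≤ ∫ x in Ioc 0 t, Real.exp (-nu * x) :=
    setIntegral_mono_on (hh.norm.integrableOn_Icc.mono_set Ioc_subset_Icc_self)
      (hexp.mono_set Ioc_subset_Ioi_self) measurableSet_Ioc fun x hx => hb x hx.1.le
  have h2 : ∫ x in Ioc 0 t, Real.exp (-nu * x) ≤ ∫ x in Ioi (0 : ℝ), Real.exp (-nu * x) :=
    setIntegral_mono_set hexp (Eventually.of_forall fun x => (Real.exp_pos _).le)
      Ioc_subset_Ioi_self.eventuallyLE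
  have h3 : ∫ x in Ioi (0 : ℝ), Real.exp (-nu * x) = 1 / nu := by
    rw [integral_exp_mul_Ioi (by linarith)]
    simp
  linarith

lemma continuous_primitive (hh : Continuous h) : Continuous fun t : ℝ => ∫ x in (0 : ℝ)..t, h x :=
  continuous_iff_continuousAt.2 fun _ =>
    (intervalIntegral.integral_hasDerivAt_right (hh.intervalIntegrable _ _)
      hh.aestronglyMeasurable.stronglyMeasurableAtFilter hh.continuousAt).continuousAt

/-- The Laplace transform of a primitive. -/
lemma laplace_primitive (hnu : 0 < nu) (hh : Continuous h)
    (hb : ∀ t, 0 ≤ t → ‖h t‖ ≤ Real.exp (-nu * t)) (hs : 0 < s.re) :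
    s * laplace (fun t => ∫ x in (0 : ℝ)..t, h x) s = laplace h s := by
  set H : ℝ → ℂ := fun t => ∫ x in (0 : ℝ)..t, h x with hH
  have hHc : Continuous H := continuous_primitive hh
  have hHb : ∀ t, 0 ≤ t → ‖H t‖ ≤ 1 / nu := fun t ht => norm_primitive_le hnu hh hb ht
  have hHi : LaplaceConverges H s := laplaceConverges_of_bounded hHc hHb hs
  have hhi : LaplaceConverges h s := laplaceConverges_of_bounded hh (M := 1)
    (fun t ht => (hb t ht).trans (Real.exp_le_one_iff.2 (by nlinarith))) hs
  -- Integrating this derivative over `(0, ∞)` gives the claim: the boundary values vanish, as `H 0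
  -- = 0` and `H` is bounded while `Re s > 0`.
  have hderiv : ∀ t : ℝ, HasDerivAt (fun t : ℝ => Complex.exp (-s * t) * H t)
      (Complex.exp (-s * t) * h t - s * (Complex.exp (-s * t) * H t)) t := fun t => by
    have h1 : HasDerivAt H (h t) t := intervalIntegral.integral_hasDerivAt_right
      (hh.intervalIntegrable _ _) hh.aestronglyMeasurable.stronglyMeasurableAtFilter hh.continuousAt
    have h2 : HasDerivAt (fun t : ℝ => Complex.exp (-s * t)) (Complex.exp (-s * t) * -s) t := by
      have := (((Complex.ofRealCLM.hasDerivAt (x := t)).const_mul (-s)).cexp)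
      simpa using this
    exact (h2.mul h1).congr_deriv (by ring)
  have hlim : Tendsto (fun t : ℝ => Complex.exp (-s * t) * H t) atTop (𝓝 0) := by
    have hz : Tendsto (fun t : ℝ => Real.exp (-s.re * t) * (1 / nu)) atTop (𝓝 0) := by
      have := (Real.tendsto_exp_neg_atTop_nhds_zero.comp
        (tendsto_id.const_mul_atTop hs)).mul_const (1 / nu)
      simpa [Function.comp_def] using this
    refine squeeze_zero_norm' ?_ hz
    filter_upwards [eventually_ge_atTop 0] with t ht
    rw [norm_mul, norm_exp_neg_mul]
    exact mul_le_mul_of_nonneg_left (hHb t ht) (Real.exp_pos _).le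
  have hsHi : IntegrableOn (fun t : ℝ => s * (Complex.exp (-s * t) * H t)) (Ioi 0) :=
    Integrable.const_mul hHi s
  have key := integral_Ioi_of_hasDerivAt_of_tendsto' (a := 0) (fun t _ => hderiv t)
    (Integrable.sub hhi hsHi) hlim
  rw [integral_sub hhi hsHi, integral_const_mul] at key
  simp only [hH, intervalIntegral.integral_same, mul_zero, sub_zero] at key
  exact (sub_eq_zero.1 key).symm

lemma laplace_congr {f g : ℝ → ℂ} (hfg : ∀ t, 0 ≤ t → f t = g t) (s : ℂ) :
    laplace f s = laplace g s :=
  setIntegral_congr_fun measurableSet_Ioi fun t ht => by simp only [hfg t (le_of_lt ht)]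

lemma LaplaceConverges.congr {f g : ℝ → ℂ} (hfg : ∀ t, 0 ≤ t → f t = g t)
    (hg : LaplaceConverges g s) : LaplaceConverges f s :=
  IntegrableOn.congr_fun hg (fun t ht => by simp only [hfg t (le_of_lt ht)]) measurableSet_Ioi

/-- Laplace transforms of `f` and of `t ↦ f t e^{-ν t} + ν ∫₀ᵗ f x e^{-ν x} dx`. -/
lemma laplace_killed {f g : ℝ → ℂ} (hnu : 0 < nu) (hf : Continuous f)
    (hb : ∀ t, 0 ≤ t → ‖f t‖ ≤ 1)
    (hg : ∀ t, 0 ≤ t → g t = f t * Complex.exp (-nu * t) +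
      nu * ∫ x in (0 : ℝ)..t, f x * Complex.exp (-nu * x)) (hs : 0 < s.re) :
    LaplaceConverges g s ∧ LaplaceConverges f (s + nu) ∧
      laplace g s = laplace f (s + nu) * (1 + nu / s) ∧
      s * laplace g s = (s + nu) * laplace f (s + nu) := by
  set h : ℝ → ℂ := fun t => f t * Complex.exp (-nu * t) with hh
  have hhc : Continuous h := by fun_prop
  have hhb : ∀ t, 0 ≤ t → ‖h t‖ ≤ Real.exp (-nu * t) := fun t ht => by
    rw [hh, norm_mul, norm_exp_neg_mul, Complex.ofReal_re]
    exact mul_le_of_le_one_left (Real.exp_pos _).le (hb t ht)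
  have hs0 : s ≠ 0 := fun h0 => by simp [h0] at hs
  -- The killing factor `exp (-nu t)` is absorbed as a shift of the argument.
  have hshift : laplace f (s + nu) = laplace h s := by
    refine setIntegral_congr_fun measurableSet_Ioi fun t _ => ?_
    simp only [hh]
    rw [mul_left_comm, ← Complex.exp_add, mul_comm]
    congr 2
    ring
  have hfi : LaplaceConverges f (s + nu) := laplaceConverges_of_bounded hf hb (by
    rw [Complex.add_re, Complex.ofReal_re]
    linarith)
  have hhi : LaplaceConverges h s := laplaceConverges_of_bounded hhc (M := 1)
    (fun t ht => (hhb t ht).trans (Real.exp_le_one_iff.2 (by nlinarith))) hs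
  have hHi : LaplaceConverges (fun t => ∫ x in (0 : ℝ)..t, h x) s :=
    laplaceConverges_of_bounded (continuous_primitive hhc)
      (fun t ht => norm_primitive_le hnu hhc hhb ht) hs
  have hnuHi : IntegrableOn (fun t : ℝ => nu * (Complex.exp (-s * t) * ∫ x in (0 : ℝ)..t, h x))
      (Ioi 0) := Integrable.const_mul hHi _
  have hgeq : ∀ t ∈ Ioi (0 : ℝ), Complex.exp (-s * t) * g t = Complex.exp (-s * t) * h t +
      nu * (Complex.exp (-s * t) * ∫ x in (0 : ℝ)..t, h x) := fun t ht => by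
    rw [hg t (le_of_lt ht)]
    ring
  have hgl : laplace g s = laplace h s + nu * laplace (fun t => ∫ x in (0 : ℝ)..t, h x) s := by
    rw [laplace, setIntegral_congr_fun measurableSet_Ioi hgeq, integral_add hhi hnuHi,
      integral_const_mul]
    rfl
  have hprim := laplace_primitive hnu hhc hhb hs
  have hsg : s * laplace g s = (s + nu) * laplace f (s + nu) := by
    rw [hgl, hshift]
    linear_combination (nu : ℂ) * hprim
  refine ⟨IntegrableOn.congr_fun (Integrable.add hhi hnuHi) (fun t ht => (hgeq t ht).symm)
    measurableSet_Ioi, hfi, ?_, hsg⟩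
  field_simp
  linear_combination hsg

end Laplace
end BatchQueue

/-! ### Assembly of the three statements -/

theorem theorem7 {Ω : Type*} [MeasurableSpace Ω] (P : Measure Ω) [IsProbabilityMeasure P]
    {k : ℕ} (lam : ℝ) (hlam : 0 < lam) (q : PMF (Fin k → ℕ))
    (ρ : Fin k → Measure ℝ) [∀ i, IsProbabilityMeasure (ρ i)]
    (S : BatchQueue.Data Ω k) (hS : S.IsModel P lam q ρ) :
    -- generating functions of the numbers in service and of the numbers served at time `t`
    (∀ z : Fin k → ℂ, (∀ i, ‖z i‖ ≤ 1) → ∀ t : ℝ, 0 ≤ t →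
      (IntervalIntegrable (fun s => BatchQueue.batchPgf q (BatchQueue.w ρ z (t - s)))
          volume 0 t ∧
        HasSum (BatchQueue.pgfTerm P (S.inService t) z)
          (Complex.exp (lam * ∫ s in (0 : ℝ)..t,
            (BatchQueue.batchPgf q (BatchQueue.w ρ z (t - s)) - 1)))) ∧
      (IntervalIntegrable (fun s => BatchQueue.batchPgf q (BatchQueue.wServed ρ z (t - s)))
          volume 0 t ∧
        HasSum (BatchQueue.pgfTerm P (S.served t) z)
          (Complex.exp (lam * ∫ s in (0 : ℝ)..t,
            (BatchQueue.batchPgf q (BatchQueue.wServed ρ z (t - s)) - 1))))) ∧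
    -- collective marks: no blue customer in service at time `t`; no batch without such a customer
    (∀ z : Fin k → ℝ, (∀ i, 0 ≤ z i ∧ z i ≤ 1) →
      ∀ red : ℕ → Fin k → ℕ → Ω → Bool, S.IsColouring P red z → ∀ t : ℝ, 0 ≤ t →
      (P.real {ω | ∀ i, ∀ c ∈ S.present t ω i, red c.1 i c.2 ω = true} : ℂ) =
          Complex.exp (lam * ∫ s in (0 : ℝ)..t,
            (BatchQueue.batchPgf q (BatchQueue.w ρ (fun i => (z i : ℂ)) (t - s)) - 1)) ∧
      (P.real {ω | ∀ n, S.arrival n ω ≤ t →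
            ∃ i j, (n, j) ∈ S.present t ω i ∧ red n i j ω = false} : ℂ) =
          Complex.exp (-(lam * ∫ s in (0 : ℝ)..t,
            BatchQueue.batchPgf q (BatchQueue.w ρ (fun i => (z i : ℂ)) (t - s))))) ∧
    -- the model with catastrophes
    (∀ (nu : ℝ), 0 < nu → ∀ C : ℕ → Ω → ℝ, S.IsCatastrophes P C nu →
      ∀ z : Fin k → ℂ, (∀ i, ‖z i‖ ≤ 1) →
      (∀ t : ℝ, 0 ≤ t →
        IntervalIntegrable (fun x : ℝ => BatchQueue.pgf P (S.inService (t - x)) z *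
            Complex.exp (-nu * (t - x))) volume 0 t ∧
        HasSum (BatchQueue.pgfTerm P (S.inServiceCat C t) z)
          (BatchQueue.pgf P (S.inService t) z * Complex.exp (-nu * t) +
            nu * ∫ x in (0 : ℝ)..t, BatchQueue.pgf P (S.inService (t - x)) z *
              Complex.exp (-nu * (t - x)))) ∧
      (∀ s : ℂ, 0 < s.re →
        BatchQueue.LaplaceConverges (fun t => BatchQueue.pgf P (S.inServiceCat C t) z) s ∧
        BatchQueue.LaplaceConverges (fun t => BatchQueue.pgf P (S.inService t) z) (s + nu) ∧
        BatchQueue.laplace (fun t => BatchQueue.pgf P (S.inServiceCat C t) z) s =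
          BatchQueue.laplace (fun t => BatchQueue.pgf P (S.inService t) z) (s + nu) *
            (1 + nu / s) ∧
        s * BatchQueue.laplace (fun t => BatchQueue.pgf P (S.inServiceCat C t) z) s =
          (s + nu) *
            BatchQueue.laplace (fun t => BatchQueue.pgf P (S.inService t) z) (s + nu))) := by
  refine ⟨fun z hz t ht => ⟨⟨BatchQueue.intervalIntegrable_batchPgf_w hz t,
    hS.hasSum_inService hlam hz ht⟩, BatchQueue.intervalIntegrable_batchPgf_wServed hz t,
    hS.hasSum_served hlam hz ht⟩, fun z hz red hred t ht => ⟨hS.prob_no_blue hlam hz hred ht,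
    hS.prob_blue_in_every_batch hlam hz hred ht⟩, fun nu hnu C hC z hz => ?_⟩
  set Ψ := BatchQueue.servicePgf lam q ρ z with hΨ
  have hΨc : Continuous Ψ := BatchQueue.continuous_servicePgf hz
  have hpgf : ∀ t : ℝ, 0 ≤ t → BatchQueue.pgf P (S.inService t) z = Ψ t := fun t ht =>
    hS.pgf_inService hlam hz ht
  have hcat : ∀ t : ℝ, 0 ≤ t → HasSum (BatchQueue.pgfTerm P (S.inServiceCat C t) z)
      (Ψ t * Complex.exp (-nu * t) +
        nu * ∫ x in (0 : ℝ)..t, Ψ x * Complex.exp (-nu * x)) := fun t ht =>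
    hS.hasSum_inServiceCat hlam hnu hC hz ht
  refine ⟨fun t ht => ?_, fun s hs => ?_⟩
  -- The explicit formula for the generating function is known only at nonnegative times, so the two
  -- integrands are compared on `[0, t]` alone.
  · have heq : EqOn (fun x : ℝ => Ψ (t - x) * Complex.exp (-nu * (t - x)))
        (fun x : ℝ => BatchQueue.pgf P (S.inService (t - x)) z * Complex.exp (-nu * (t - x)))
        (uIcc 0 t) := fun x hx => by
      rw [uIcc_of_le ht] at hx
      simp only [hpgf (t - x) (by linarith [hx.2])]
    have hc : Continuous fun x : ℝ => Ψ (t - x) * Complex.exp (-nu * (t - x)) := by fun_prop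
    refine ⟨(hc.intervalIntegrable 0 t).congr (heq.mono uIoc_subset_uIcc), ?_⟩
    -- The substitution of `t - x` for `x` passes from the integral over the age to the stated
    -- integral.
    have hsub := intervalIntegral.integral_comp_sub_left (a := 0) (b := t)
      (fun x : ℝ => Ψ x * Complex.exp (-nu * x)) t
    rw [sub_self, sub_zero] at hsub
    rw [hpgf t ht, ← intervalIntegral.integral_congr heq]
    have h := hcat t ht
    rw [← hsub] at h
    push_cast at h
    exact h
  · have hkilled := BatchQueue.laplace_killed (s := s)
      (g := fun t => BatchQueue.pgf P (S.inServiceCat C t) z) hnu hΨc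
      (fun t ht => BatchQueue.norm_servicePgf_le_one hlam hz ht)
      (fun t ht => (hcat t ht).tsum_eq) hs
    rw [← BatchQueue.laplace_congr hpgf] at hkilled
    exact ⟨hkilled.1, hkilled.2.1.congr hpgf, hkilled.2.2⟩
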